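/- Let $\mathbb{R}^4_2$ be $\mathbb{R}^4$ with the metric $\langle\,,\rangle=-dx_0^2-dx_1^2+dx_2^2+dx_3^2$ and, writing its points as $a+bi+cj+dk$, with the associative bilinear product determined by $i^2=-1$, $j^2=k^2=1$, $ij=k=-ji$, $jk=-i=-kj$, $ki=j=-ik$; let $\overline{a+bi+cj+dk}=a-bi-cj-dk$, and let $\mathbb{H}^3_1=\{z:\langle z,z\rangle=-1\}$ be the anti-de Sitter space. If $a:\mathbb{R}\to\mathbb{H}^3_1$ is a smooth curve with $\langle a',a\,j\rangle=0$, then $\overline{a}\,a'=\lambda i+\mu k$; the parameter of $a$ is called asymptotic if $\lambda^2+\mu^2=1$, and then a smooth function $\omega^a$ with $\overline{a}\,a'=\cos\omega^a\,i+\sin\omega^a\,k$ is an angle function of $a$. **Theorem.** Let $b_1,b_2:\mathbb{R}\to\mathbb{H}^3_1$ be smooth curves with $b_1(0)=b_2(0)=1$, $-\langle b_1',b_1'\rangle=\langle b_2',b_2'\rangle=1$ and $\langle b_1',b_1 j\rangle=\langle b_2',b_2 j\rangle=0$, and let $f:\mathbb{R}^2\to\mathbb{H}^3_1$, $f(s,t)=b_1(s)\,\overline{b_2(t)}$.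 Then $f$ is an immersion on all of $\mathbb{R}^2$ whose induced metric is Lorentzian and flat, and: 1. The asymptotic parameters $(u,v)$ of $f$ are globally defined on $\mathbb{R}^2$: there are smooth diffeomorphisms $s\mapsto u(s)$, $t\mapsto v(t)$ of $\mathbb{R}$ onto $\mathbb{R}$ fixing $0$ such that $u$ and $v$ are asymptotic parameters of $b_1$ and $b_2$, and such that, for suitable smooth $\omega_1(u)$, $\omega_2(v)$ for which $\omega_1$ and $\pi-\omega_2$ are angle functions of the reparametrized curves $b_1$ and $b_2$, one has $0<\omega_1(u)+\omega_2(v)<\pi$ for all $(u,v)\in\mathbb{R}^2$ and, for a smooth unit normal $N$, the fundamental forms $I=\langle df,df\rangle$, $II=-\langle df,dN\rangle$, $III=\langle dN,dN\rangle$ of $f$ are $$I=-\cos(2\omega_1)\,du^2-2\cos(\omega_1-\omega_2)\,du\,dv-\cos(2\omega_2)\,dv^2,$$ $$II=2\sin(\omega_1+\omega_2)\,du\,dv,$$ $$III=\cos(2\omega_1)\,du^2-2\cos(\omega_1-\omega_2)\,du\,dv+\cos(2\omega_2)\,dv^2.$$ 2. Let $u=u(s)$, $v=v(t)$ be any smooth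 diffeomorphisms of $\mathbb{R}$ that are asymptotic parameters of $b_1$ and $b_2$, and let $\omega_1(u)$ and $\pi-\omega_2(v)$ be angle functions of the reparametrized curves. If the angle function $\omega(u,v)=\omega_1(u)+\omega_2(v)$ satisfies $\sin\omega(u,v)\ge c$ for some constant $c>0$ and all $(u,v)\in\mathbb{R}^2$, then the surface $f$ (that is, $\mathbb{R}^2$ with the metric induced by $f$) is geodesically complete. 3. There exist curves $b_1,b_2$ satisfying all of the above hypotheses for which the surface $f$ is not geodesically complete. (So the question Q2 of Dajczer and Nomizu, whether the surface is complete whenever it is immersed on all of $\mathbb{R}^2$, has a negative answer.) -/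

import Mathlib

open scoped ContDiff Matrix

noncomputable section

namespace AntiDeSitter

/-! ### The pseudo-quaternions and the anti-de Sitter space -/

/-- The vector space `ℝ⁴`, with coordinates with respect to the basis `1, i, j, k`. -/
abbrev R42 : Type := Fin 4 → ℝ

/-- The neutral metric `-dx₀² - dx₁² + dx₂² + dx₃²`. -/
def ip (z w : R42) : ℝ := -(z 0 * w 0) - z 1 * w 1 + z 2 * w 2 + z 3 * w 3

/-- The product with `i² = -1`, `j² = k² = 1`, `ij = k = -ji`, `jk = -i = -kj`,
`ki = j = -ik`. -/
def mul (z w : R42) : R42 :=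
  ![z 0 * w 0 - z 1 * w 1 + z 2 * w 2 + z 3 * w 3,
    z 0 * w 1 + z 1 * w 0 - z 2 * w 3 + z 3 * w 2,
    z 0 * w 2 + z 2 * w 0 - z 1 * w 3 + z 3 * w 1,
    z 0 * w 3 + z 3 * w 0 + z 1 * w 2 - z 2 * w 1]

/-- The conjugate `a - bi - cj - dk` of `a + bi + cj + dk`. -/
def conj (z : R42) : R42 := ![z 0, -z 1, -z 2, -z 3]

/-- The unit `1`. -/
def one : R42 := ![1, 0, 0, 0]

/-- The imaginary unit `i`. -/
def qi : R42 := ![0, 1, 0, 0]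

/-- The imaginary unit `j`. -/
def qj : R42 := ![0, 0, 1, 0]

/-- The imaginary unit `k`. -/
def qk : R42 := ![0, 0, 0, 1]

/-- `mul` is the product of Mathlib's quaternion algebra with `i² = -1`, `j² = 1`. -/
theorem mul_eq_quaternionAlgebra (z w : R42) :
    mul z w = QuaternionAlgebra.equivTuple (-1 : ℝ) 0 1
      ((QuaternionAlgebra.equivTuple (-1 : ℝ) 0 1).symm z *
        (QuaternionAlgebra.equivTuple (-1 : ℝ) 0 1).symm w) := by
  ext n
  fin_cases n <;> simp [mul] <;> ring

/-- The anti-de Sitter space `{z | ⟨z, z⟩ = -1}`. -/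
def H31 : Set R42 := {z | ip z z = -1}

/-! ### Metrics on the coordinate plane, geodesics, flatness -/

/-- The coordinate plane `ℝ²`. -/
abbrev Plane : Type := Fin 2 → ℝ

/-- The partial derivative in the `i`-th coordinate direction. -/
def pd {E : Type*} [NormedAddCommGroup E] [NormedSpace ℝ E] (i : Fin 2) (h : Plane → E)
    (p : Plane) : E :=
  fderiv ℝ h p (Pi.single i 1)

/-- A field of bilinear forms on the plane, by its matrix in the coordinates. -/
abbrev Form : Type := Plane → Matrix (Fin 2) (Fin 2) ℝ

/-- A symmetric bilinear form on a plane has signature `(-, +)` exactly when its determinant is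
negative. -/
def IsLorentzian (g : Form) : Prop := ∀ p, (g p).IsSymm ∧ (g p).det < 0

/-- The Christoffel symbol `Γᵏᵢⱼ` of the Levi-Civita connection of `g`. -/
def christoffel (g : Form) (k i j : Fin 2) (p : Plane) : ℝ :=
  (1 / 2) * ∑ l, (g p)⁻¹ k l *
    (pd i (fun q => g q j l) p + pd j (fun q => g q i l) p - pd l (fun q => g q i j) p)

/-- Geodesics of `g` that are defined on all of `ℝ`. -/
def IsGeodesic (g : Form) (γ : ℝ → Plane) : Prop :=
  ContDiff ℝ ∞ γ ∧ ∀ (τ : ℝ) (k : Fin 2),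
    deriv (deriv γ) τ k
      + ∑ i, ∑ j, christoffel g k i j (γ τ) * deriv γ τ i * deriv γ τ j = 0

/-- Geodesic completeness: the geodesic with any given initial position and velocity is defined
on all of `ℝ`. -/
def GeodesicallyComplete (g : Form) : Prop :=
  ∀ p v : Plane, ∃ γ : ℝ → Plane, IsGeodesic g γ ∧ γ 0 = p ∧ deriv γ 0 = v

/-- Flatness of a Lorentzian metric: it is locally isometric to the Lorentz plane
`(ℝ², -dx² + dy²)`. -/
def IsFlat (g : Form) : Prop :=
  ∀ p : Plane, ∃ U : Set Plane, IsOpen U ∧ p ∈ U ∧ ∃ x y : Plane → ℝ,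
    ContDiffOn ℝ ∞ x U ∧ ContDiffOn ℝ ∞ y U ∧ Set.InjOn (fun q => (x q, y q)) U ∧
    ∀ q ∈ U, ∀ i j : Fin 2, g q i j = -(pd i x q * pd j x q) + pd i y q * pd j y q

/-! ### Surfaces in the anti-de Sitter space -/

/-- The first fundamental form `⟨df, df⟩`, i.e. the induced metric. -/
def firstForm (f : Plane → R42) : Form :=
  fun p => Matrix.of fun i j => ip (pd i f p) (pd j f p)

/-- The second fundamental form `-⟨df, dN⟩`. -/
def secondForm (f N : Plane → R42) : Form :=
  fun p => Matrix.of fun i j => -ip (pd i f p) (pd j N p)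

/-- The third fundamental form `⟨dN, dN⟩`. -/
def thirdForm (N : Plane → R42) : Form :=
  fun p => Matrix.of fun i j => ip (pd i N p) (pd j N p)

/-- `f` is a smooth immersed surface of `H³₁` without singular points, defined on all of `ℝ²`. -/
structure IsImmersion (f : Plane → R42) : Prop where
  smooth : ContDiff ℝ ∞ f
  mem : ∀ p, f p ∈ H31
  injective : ∀ p, Function.Injective (fderiv ℝ f p)

/-- `N` is a smooth unit normal of the timelike surface `f` of `H³₁`. -/
structure IsUnitNormal (f N : Plane → R42) : Prop where
  smooth : ContDiff ℝ ∞ N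
  unit : ∀ p, ip (N p) (N p) = 1
  normal : ∀ p, ip (N p) (f p) = 0
  normal_pd : ∀ p i, ip (N p) (pd i f p) = 0

/-- The surface `(s, t) ↦ b₁(s) · conj (b₂(t))`. -/
def surface (b₁ b₂ : ℝ → R42) : Plane → R42 :=
  fun p => mul (b₁ (p 0)) (conj (b₂ (p 1)))

/-- A timelike and a spacelike unit-speed curve of `H³₁` through `1` that are orthogonal to the
left-invariant field generated by `j`. -/
structure IsCurvePair (b₁ b₂ : ℝ → R42) : Prop where
  smooth₁ : ContDiff ℝ ∞ b₁
  smooth₂ : ContDiff ℝ ∞ b₂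
  mem₁ : ∀ s, b₁ s ∈ H31
  mem₂ : ∀ t, b₂ t ∈ H31
  zero₁ : b₁ 0 = one
  zero₂ : b₂ 0 = one
  timelike₁ : ∀ s, ip (deriv b₁ s) (deriv b₁ s) = -1
  spacelike₂ : ∀ t, ip (deriv b₂ t) (deriv b₂ t) = 1
  orth₁ : ∀ s, ip (deriv b₁ s) (mul (b₁ s) qj) = 0
  orth₂ : ∀ t, ip (deriv b₂ t) (mul (b₂ t) qj) = 0

/-! ### Asymptotic parameters -/

/-- The parameter of the curve `a` of `H³₁` is its asymptotic parameter: `⟨a', a j⟩ = 0` and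
`conj a · a' = λ i + μ k` with `λ² + μ² = 1`. -/
structure IsAsymptoticParameter (a : ℝ → R42) : Prop where
  smooth : ContDiff ℝ ∞ a
  mem : ∀ r, a r ∈ H31
  orth : ∀ r, ip (deriv a r) (mul (a r) qj) = 0
  normalized : ∀ r, ∃ l m : ℝ,
    mul (conj (a r)) (deriv a r) = l • qi + m • qk ∧ l ^ 2 + m ^ 2 = 1

/-- `θ` is an angle function of the curve `a`: `conj a · a' = cos θ i + sin θ k`. -/
def IsAngleFunction (a : ℝ → R42) (θ : ℝ → ℝ) : Prop :=
  ContDiff ℝ ∞ θ ∧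
    ∀ r, mul (conj (a r)) (deriv a r) = Real.cos (θ r) • qi + Real.sin (θ r) • qk

/-- The changes of parameter `u = u(s)`, `v = v(t)` are smooth diffeomorphisms of `ℝ`, `u` and `v`
are the asymptotic parameters of `b₁` and `b₂`, and the angle functions of these two curves are
`ω₁` and `π - ω₂`. The angle function of the surface is then `ω₁(u) + ω₂(v)`. -/
structure AsymptoticParameters (b₁ b₂ : ℝ → R42) (u v : ℝ ≃ ℝ) (ω₁ ω₂ : ℝ → ℝ) : Prop where
  smooth_u : ContDiff ℝ ∞ u
  smooth_u_symm : ContDiff ℝ ∞ u.symm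
  smooth_v : ContDiff ℝ ∞ v
  smooth_v_symm : ContDiff ℝ ∞ v.symm
  param₁ : IsAsymptoticParameter (b₁ ∘ u.symm)
  param₂ : IsAsymptoticParameter (b₂ ∘ v.symm)
  angle₁ : IsAngleFunction (b₁ ∘ u.symm) ω₁
  angle₂ : IsAngleFunction (b₂ ∘ v.symm) (fun r => Real.pi - ω₂ r)

/-- In the coordinates `(u, v)` of the plane the fundamental forms of the surface `f` are
`I = -cos 2ω₁ du² - 2 cos (ω₁ - ω₂) du dv - cos 2ω₂ dv²`, `II = 2 sin (ω₁ + ω₂) du dv` and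
`III = cos 2ω₁ du² - 2 cos (ω₁ - ω₂) du dv + cos 2ω₂ dv²`, for a unit normal `N`. In particular
the coordinate curves are the asymptotic curves. -/
def HasAsymptoticForms (f : Plane → R42) (ω₁ ω₂ : ℝ → ℝ) : Prop :=
  ∃ N : Plane → R42, IsUnitNormal f N ∧ ∀ p : Plane,
    firstForm f p =
      !![-Real.cos (2 * ω₁ (p 0)), -Real.cos (ω₁ (p 0) - ω₂ (p 1));
         -Real.cos (ω₁ (p 0) - ω₂ (p 1)), -Real.cos (2 * ω₂ (p 1))] ∧
    secondForm f N p =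
      !![0, Real.sin (ω₁ (p 0) + ω₂ (p 1));
         Real.sin (ω₁ (p 0) + ω₂ (p 1)), 0] ∧
    thirdForm N p =
      !![Real.cos (2 * ω₁ (p 0)), -Real.cos (ω₁ (p 0) - ω₂ (p 1));
         -Real.cos (ω₁ (p 0) - ω₂ (p 1)), Real.cos (2 * ω₂ (p 1))]

end AntiDeSitter

end

noncomputable section

namespace AntiDeSitter

/-! ### Algebra of the pseudo-quaternions -/

/-! The hypotheses on the curves say `b' = b (l i + m k)`, where `l₁² - m₁² = 1` for `b₁` and `m₂² -
l₂² = 1` for `b₂`. The map `x ↦ b₁ x conj b₂` is an isometry of `ℝ⁴`, so the induced metric is `-(l₁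
ds - l₂ dt)² + (m₁ ds - m₂ dt)²`. Both one-forms are closed. With primitives `A₁, A₂, B₁, B₂` of the
frame functions, the metric is therefore the pullback of the Lorentz plane under `translationMap`,
`Φ(s,t) = (A₁ s - B₁ t, A₂ s - B₂ t)`, a local diffeomorphism. This gives immersion, signature and
flatness, and the geodesics are the curves that `Φ` sends to affinely parametrized lines
(`isGeodesic_arcLengthForm_iff`).

Asymptotic parameters: `l² + m² ≥ 1`, so a primitive of `±√(l² + m²)` is a diffeomorphism of the
line. With suitable signs the angles fall in the ranges of `arcsin` and `arccos`. The normal `b₁ j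
conj b₂` yields the three forms.

Completeness: in asymptotic parameters `Φ` is the difference of two plane curves of Euclidean unit
speed whose directions meet at an angle with sine at least `c`. Chords of the two curves are then
uniformly transversal (`mul_abs_mul_abs_le_det`). Hence `Φ` is antilipschitz with open and closed
image, so bijective (`bijective_translationMap`), and lines lift to complete geodesics.

Incompleteness: explicit curves are chosen for which `Φ` takes values in a half plane bounded by a
null line; a geodesic heading for that line must stop. -/

/-- The vector `l i + m k`. -/
def ikVec (l m : ℝ) : R42 := ![0, l, 0, m]

theorem ikVec_eq (l m : ℝ) : ikVec l m = l • qi + m • qk := by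
  ext n
  fin_cases n <;> simp [ikVec, qi, qk]

theorem mul_assoc' (x y z : R42) : mul (mul x y) z = mul x (mul y z) := by
  ext n
  fin_cases n <;> simp [mul] <;> ring

/-- Polarized multiplicativity of the norm `z conj z = -⟨z, z⟩`. Multiplication on both sides by
elements of `H31` is therefore an isometry, as used in `ip_sandwich`. -/
theorem ip_mul_mul (x y z w : R42) :
    ip (mul (mul x y) w) (mul (mul x z) w) = ip x x * ip y z * ip w w := by
  simp [mul, ip]
  ring

theorem ip_mul_left (x y z : R42) : ip (mul x y) (mul x z) = -(ip x x * ip y z) := by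
  simp [mul, ip]
  ring

theorem ip_mul_self (x y : R42) : ip (mul x y) (mul x y) = -(ip x x * ip y y) :=
  ip_mul_left x y y

theorem ip_conj (x : R42) : ip (conj x) (conj x) = ip x x := by
  simp [conj, ip]

theorem conj_mul_mul {x : R42} (hx : x ∈ H31) (y : R42) : mul (conj x) (mul x y) = y := by
  have hx' : ip x x = -1 := hx
  rw [← mul_assoc']
  have h : mul (conj x) x = one := by
    simp only [ip] at hx'
    ext n
    fin_cases n <;> simp [mul, conj, one] <;> linarith
  rw [h]
  ext n
  fin_cases n <;> simp [mul, one]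

theorem mul_conj_mul {x : R42} (hx : x ∈ H31) (y : R42) : mul x (mul (conj x) y) = y := by
  have hx' : ip x x = -1 := hx
  rw [← mul_assoc']
  have h : mul x (conj x) = one := by
    simp only [ip] at hx'
    ext n
    fin_cases n <;> simp [mul, conj, one] <;> linarith
  rw [h]
  ext n
  fin_cases n <;> simp [mul, one]

theorem conj_mul (x y : R42) : conj (mul x y) = mul (conj y) (conj x) := by
  ext n
  fin_cases n <;> simp [mul, conj] <;> ring

theorem conj_ikVec (l m : ℝ) : conj (ikVec l m) = ikVec (-l) (-m) := by
  ext n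
  fin_cases n <;> simp [ikVec, conj]

theorem ip_ikVec (l m l' m' : ℝ) : ip (ikVec l m) (ikVec l' m') = -(l * l') + m * m' := by
  simp [ip, ikVec]

theorem ikVec_mul_qj (l m : ℝ) : mul (ikVec l m) qj = ikVec m l := by
  ext n
  fin_cases n <;> simp [ikVec, mul, qj]

theorem qj_mul_ikVec (l m : ℝ) : mul qj (ikVec l m) = ikVec (-m) (-l) := by
  ext n
  fin_cases n <;> simp [ikVec, mul, qj]

/-! ### Differentiation -/

theorem hasDerivAt_mul {a b : ℝ → R42} {a' b' : R42} {s : ℝ} (ha : HasDerivAt a a' s)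
    (hb : HasDerivAt b b' s) :
    HasDerivAt (fun r => mul (a r) (b r)) (mul a' (b s) + mul (a s) b') s := by
  have ha' := hasDerivAt_pi.1 ha
  have hb' := hasDerivAt_pi.1 hb
  have key : ∀ i j, HasDerivAt (fun r => a r i * b r j) (a' i * b s j + a s i * b' j) s :=
    fun i j => (ha' i).mul (hb' j)
  refine hasDerivAt_pi.2 fun n => ?_
  fin_cases n
  · exact ((((key 0 0).sub (key 1 1)).add (key 2 2)).add (key 3 3)).congr_deriv
      (by simp [mul]; ring)
  · exact ((((key 0 1).add (key 1 0)).sub (key 2 3)).add (key 3 2)).congr_deriv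
      (by simp [mul]; ring)
  · exact ((((key 0 2).add (key 2 0)).sub (key 1 3)).add (key 3 1)).congr_deriv
      (by simp [mul]; ring)
  · exact ((((key 0 3).add (key 3 0)).add (key 1 2)).sub (key 2 1)).congr_deriv
      (by simp [mul]; ring)

theorem hasDerivAt_conj {a : ℝ → R42} {a' : R42} {s : ℝ} (ha : HasDerivAt a a' s) :
    HasDerivAt (fun r => conj (a r)) (conj a') s := by
  have ha' := hasDerivAt_pi.1 ha
  refine hasDerivAt_pi.2 fun n => ?_
  fin_cases n
  · exact ha' 0
  · exact (ha' 1).neg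
  · exact (ha' 2).neg
  · exact (ha' 3).neg

theorem contDiff_mul {E : Type*} [NormedAddCommGroup E] [NormedSpace ℝ E] {a b : E → R42}
    (ha : ContDiff ℝ ∞ a) (hb : ContDiff ℝ ∞ b) : ContDiff ℝ ∞ fun r => mul (a r) (b r) := by
  have ha' := contDiff_pi.1 ha
  have hb' := contDiff_pi.1 hb
  have key : ∀ i j, ContDiff ℝ ∞ fun r => a r i * b r j := fun i j => (ha' i).mul (hb' j)
  refine contDiff_pi.2 fun n => ?_
  fin_cases n
  · exact ((((key 0 0).sub (key 1 1)).add (key 2 2)).add (key 3 3))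
  · exact ((((key 0 1).add (key 1 0)).sub (key 2 3)).add (key 3 2))
  · exact ((((key 0 2).add (key 2 0)).sub (key 1 3)).add (key 3 1))
  · exact ((((key 0 3).add (key 3 0)).add (key 1 2)).sub (key 2 1))

theorem contDiff_conj {E : Type*} [NormedAddCommGroup E] [NormedSpace ℝ E] {a : E → R42}
    (ha : ContDiff ℝ ∞ a) : ContDiff ℝ ∞ fun r => conj (a r) := by
  have ha' := contDiff_pi.1 ha
  refine contDiff_pi.2 fun n => ?_
  fin_cases n
  · exact ha' 0
  · exact (ha' 1).neg
  · exact (ha' 2).neg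
  · exact (ha' 3).neg

theorem pd_eq {E : Type*} [NormedAddCommGroup E] [NormedSpace ℝ E] {h : Plane → E} {p : Plane}
    {i : Fin 2} {h' : E} (hd : DifferentiableAt ℝ h p)
    (hh : HasDerivAt (fun r => h (Function.update p i r)) h' (p i)) : pd i h p = h' := by
  have hp : Function.update p i (p i) = p := Function.update_eq_self i p
  have h1 := (hp.symm ▸ hd.hasFDerivAt : HasFDerivAt h (fderiv ℝ h p) _).comp_hasDerivAt (p i)
    (hasDerivAt_update p i (p i))
  exact h1.unique hh

theorem fderiv_eq_pd {E : Type*} [NormedAddCommGroup E] [NormedSpace ℝ E] (h : Plane → E)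
    (p v : Plane) : fderiv ℝ h p v = v 0 • pd 0 h p + v 1 • pd 1 h p := by
  have hv : v = v 0 • Pi.single 0 1 + v 1 • Pi.single 1 1 := by
    ext n
    fin_cases n <;> simp
  conv_lhs => rw [hv]
  simp [pd]

theorem contDiff_coord (i : Fin 2) : ContDiff ℝ ∞ fun p : Plane => p i :=
  contDiff_apply ℝ ℝ i

section Product

variable {a c : ℝ → R42}

theorem contDiff_product (ha : ContDiff ℝ ∞ a) (hc : ContDiff ℝ ∞ c) :
    ContDiff ℝ ∞ fun p : Plane => mul (a (p 0)) (c (p 1)) :=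
  contDiff_mul (ha.comp (contDiff_coord 0)) (hc.comp (contDiff_coord 1))

theorem pd_zero_product (ha : ContDiff ℝ ∞ a) (hc : ContDiff ℝ ∞ c) {a' : R42} {p : Plane}
    (h : HasDerivAt a a' (p 0)) :
    pd 0 (fun p : Plane => mul (a (p 0)) (c (p 1))) p = mul a' (c (p 1)) := by
  refine pd_eq ((contDiff_product ha hc).differentiable (by simp) p) ?_
  have := hasDerivAt_mul h (hasDerivAt_const (p 0) (c (p 1)))
  simp only [Function.update_self, ne_eq, one_ne_zero, not_false_eq_true, Function.update_of_ne]
  refine this.congr_deriv ?_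
  ext n
  fin_cases n <;> simp [mul]

theorem pd_one_product (ha : ContDiff ℝ ∞ a) (hc : ContDiff ℝ ∞ c) {c' : R42} {p : Plane}
    (h : HasDerivAt c c' (p 1)) :
    pd 1 (fun p : Plane => mul (a (p 0)) (c (p 1))) p = mul (a (p 0)) c' := by
  refine pd_eq ((contDiff_product ha hc).differentiable (by simp) p) ?_
  have := hasDerivAt_mul (hasDerivAt_const (p 1) (a (p 0))) h
  simp only [Function.update_self, ne_eq, zero_ne_one, not_false_eq_true, Function.update_of_ne]
  refine this.congr_deriv ?_
  ext n
  fin_cases n <;> simp [mul]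

end Product

/-! ### Horizontal curves and their product surfaces -/

/-- A smooth curve of `H³₁` with `conj a · a' = l i + m k`. -/
structure IsHorizontal (a : ℝ → R42) (l m : ℝ → ℝ) : Prop where
  smooth : ContDiff ℝ ∞ a
  mem : ∀ s, a s ∈ H31
  deriv : ∀ s, HasDerivAt a (mul (a s) (ikVec (l s) (m s))) s

/-- Of the four components of `conj a · a'`, the real one vanishes because `⟨a, a⟩` is constant and
the `j` one by the orthogonality hypothesis. -/
theorem isHorizontal_of_orth {a : ℝ → R42} (ha : ContDiff ℝ ∞ a) (hmem : ∀ s, a s ∈ H31)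
    (horth : ∀ s, ip (deriv a s) (mul (a s) qj) = 0) :
    ∃ l m : ℝ → ℝ, ContDiff ℝ ∞ l ∧ ContDiff ℝ ∞ m ∧ IsHorizontal a l m := by
  have hd : ∀ s, HasDerivAt a (deriv a s) s := fun s =>
    (ha.differentiable (by simp) s).hasDerivAt
  have hsm : ContDiff ℝ ∞ (deriv a) := (contDiff_infty_iff_deriv.1 ha).2
  have hx : ContDiff ℝ ∞ fun s => mul (conj (a s)) (deriv a s) := contDiff_mul (contDiff_conj ha) hsm
  refine ⟨fun s => mul (conj (a s)) (deriv a s) 1, fun s => mul (conj (a s)) (deriv a s) 3,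
    contDiff_pi.1 hx 1, contDiff_pi.1 hx 3, ha, hmem, fun s => ?_⟩
  have h0 : mul (conj (a s)) (deriv a s) 0 = 0 := by
    have hc : (fun r => ip (a r) (a r)) = fun _ => -1 := funext hmem
    have hp := hasDerivAt_pi.1 (hd s)
    have h1 := ((((hp 0).mul (hp 0)).neg.sub ((hp 1).mul (hp 1))).add ((hp 2).mul (hp 2))).add
      ((hp 3).mul (hp 3))
    have h2 : HasDerivAt (fun r => ip (a r) (a r)) 0 s := by
      rw [hc]
      exact hasDerivAt_const s _
    have h3 := h1.unique h2
    simp [mul, conj]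
    linarith
  have h2 : mul (conj (a s)) (deriv a s) 2 = 0 := by
    have := horth s
    simp [ip, mul, qj] at this
    simp [mul, conj]
    linarith
  have : ikVec (mul (conj (a s)) (deriv a s) 1) (mul (conj (a s)) (deriv a s) 3)
      = mul (conj (a s)) (deriv a s) := by
    ext n
    fin_cases n
    · exact h0.symm
    · rfl
    · exact h2.symm
    · rfl
  rw [this, mul_conj_mul (hmem s)]
  exact hd s

namespace IsHorizontal

variable {a b : ℝ → R42} {l m l₁ m₁ l₂ m₂ : ℝ → ℝ}

theorem conj_mul_deriv (h : IsHorizontal a l m) (s : ℝ) :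
    mul (conj (a s)) (_root_.deriv a s) = l s • qi + m s • qk := by
  rw [(h.deriv s).deriv, conj_mul_mul (h.mem s), ikVec_eq]

theorem ip_deriv (h : IsHorizontal a l m) (s : ℝ) :
    ip (_root_.deriv a s) (_root_.deriv a s) = -(l s) ^ 2 + m s ^ 2 := by
  have hm : ip (a s) (a s) = -1 := h.mem s
  rw [(h.deriv s).deriv, ip_mul_self, ip_ikVec, hm]
  ring

theorem ip_deriv_qj (h : IsHorizontal a l m) (s : ℝ) :
    ip (_root_.deriv a s) (mul (a s) qj) = 0 := by
  rw [(h.deriv s).deriv, ip_mul_left]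
  simp [ip, ikVec, qj]

theorem hasDerivAt_conj (h : IsHorizontal a l m) (s : ℝ) :
    HasDerivAt (fun r => conj (a r)) (mul (ikVec (-(l s)) (-(m s))) (conj (a s))) s := by
  refine (AntiDeSitter.hasDerivAt_conj (h.deriv s)).congr_deriv ?_
  rw [conj_mul, conj_ikVec]

theorem contDiff_surface (h₁ : IsHorizontal a l₁ m₁) (h₂ : IsHorizontal b l₂ m₂) :
    ContDiff ℝ ∞ (surface a b) :=
  contDiff_product h₁.smooth (contDiff_conj h₂.smooth)

theorem pd_zero_surface (h₁ : IsHorizontal a l₁ m₁) (h₂ : IsHorizontal b l₂ m₂) (p : Plane) :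
    pd 0 (surface a b) p
      = mul (mul (a (p 0)) (ikVec (l₁ (p 0)) (m₁ (p 0)))) (conj (b (p 1))) :=
  pd_zero_product h₁.smooth (contDiff_conj h₂.smooth) (h₁.deriv _)

theorem pd_one_surface (h₁ : IsHorizontal a l₁ m₁) (h₂ : IsHorizontal b l₂ m₂) (p : Plane) :
    pd 1 (surface a b) p
      = mul (mul (a (p 0)) (ikVec (-(l₂ (p 1))) (-(m₂ (p 1))))) (conj (b (p 1))) := by
  rw [mul_assoc']
  exact pd_one_product h₁.smooth (contDiff_conj h₂.smooth) (h₂.hasDerivAt_conj _)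

theorem ip_sandwich (h₁ : IsHorizontal a l₁ m₁) (h₂ : IsHorizontal b l₂ m₂) (s t : ℝ)
    (x y : R42) :
    ip (mul (mul (a s) x) (conj (b t))) (mul (mul (a s) y) (conj (b t))) = ip x y := by
  have ha : ip (a s) (a s) = -1 := h₁.mem s
  have hb : ip (b t) (b t) = -1 := h₂.mem t
  rw [ip_mul_mul, ip_conj, ha, hb]
  ring

theorem firstForm_surface (h₁ : IsHorizontal a l₁ m₁) (h₂ : IsHorizontal b l₂ m₂) (p : Plane) :
    firstForm (surface a b) p =
      !![-(l₁ (p 0)) ^ 2 + m₁ (p 0) ^ 2, l₁ (p 0) * l₂ (p 1) - m₁ (p 0) * m₂ (p 1);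
         l₁ (p 0) * l₂ (p 1) - m₁ (p 0) * m₂ (p 1), -(l₂ (p 1)) ^ 2 + m₂ (p 1) ^ 2] := by
  ext i j
  fin_cases i <;> fin_cases j <;>
    simp only [firstForm, Matrix.of_apply, Fin.zero_eta, Fin.mk_one, h₁.pd_zero_surface h₂,
      h₁.pd_one_surface h₂, h₁.ip_sandwich h₂, ip_ikVec, Matrix.cons_val', Matrix.cons_val_zero,
      Matrix.cons_val_one, Matrix.cons_val_fin_one] <;> ring

theorem surface_mem (h₁ : IsHorizontal a l₁ m₁) (h₂ : IsHorizontal b l₂ m₂) (p : Plane) :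
    surface a b p ∈ H31 := by
  have ha : ip (a (p 0)) (a (p 0)) = -1 := h₁.mem _
  have hb : ip (b (p 1)) (b (p 1)) = -1 := h₂.mem _
  change ip (mul _ _) (mul _ _) = -1
  rw [ip_mul_left, ip_conj, ha, hb]
  ring

end IsHorizontal

theorem ip_combination (α β : ℝ) (x y z : R42) :
    ip (α • x + β • y) z = α * ip x z + β * ip y z := by
  simp [ip]
  ring

/-- A kernel vector of `df` lies in the radical of the first form; Cramer's rule then kills both
coordinates. -/
theorem fderiv_injective_of_det_ne_zero {f : Plane → R42} {p : Plane}
    (h : (firstForm f p).det ≠ 0) : Function.Injective (fderiv ℝ f p) := by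
  rw [injective_iff_map_eq_zero]
  intro v hv
  rw [fderiv_eq_pd] at hv
  have hz : ∀ z, v 0 * ip (pd 0 f p) z + v 1 * ip (pd 1 f p) z = 0 := fun z => by
    rw [← ip_combination, hv]
    simp [ip]
  have h0 := hz (pd 0 f p)
  have h1 := hz (pd 1 f p)
  rw [Matrix.det_fin_two] at h
  simp only [firstForm, Matrix.of_apply] at h
  ext n
  fin_cases n
  · refine (mul_eq_zero.1 (?_ : v 0 * _ = 0)).resolve_right h
    linear_combination (ip (pd 1 f p) (pd 1 f p)) * h0 - ip (pd 1 f p) (pd 0 f p) * h1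
  · refine (mul_eq_zero.1 (?_ : v 1 * _ = 0)).resolve_right h
    linear_combination (ip (pd 0 f p) (pd 0 f p)) * h1 - ip (pd 0 f p) (pd 1 f p) * h0

/-! ### The developing map -/

theorem exists_primitive {g : ℝ → ℝ} (hg : ContDiff ℝ ∞ g) :
    ∃ G : ℝ → ℝ, ContDiff ℝ ∞ G ∧ G 0 = 0 ∧ ∀ s, HasDerivAt G (g s) s := by
  have hd : ∀ s, HasDerivAt (fun x => ∫ r in (0 : ℝ)..x, g r) (g s) s := fun s =>
    hg.continuous.integral_hasStrictDerivAt 0 s |>.hasDerivAt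
  refine ⟨fun x => ∫ r in (0 : ℝ)..x, g r, ?_, by simp, hd⟩
  refine contDiff_infty_iff_deriv.2 ⟨fun s => (hd s).differentiableAt, ?_⟩
  rwa [funext fun s => (hd s).deriv]

/-- The map `(s, t) ↦ (A₁ s - B₁ t, A₂ s - B₂ t)`. -/
def translationMap (A₁ A₂ B₁ B₂ : ℝ → ℝ) : Plane → Plane :=
  fun p => ![A₁ (p 0) - B₁ (p 1), A₂ (p 0) - B₂ (p 1)]

section Difference

variable {A B : ℝ → ℝ}

theorem contDiff_difference (hA : ContDiff ℝ ∞ A) (hB : ContDiff ℝ ∞ B) :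
    ContDiff ℝ ∞ fun p : Plane => A (p 0) - B (p 1) :=
  (hA.comp (contDiff_coord 0)).sub (hB.comp (contDiff_coord 1))

theorem pd_zero_difference (hA : ContDiff ℝ ∞ A) (hB : ContDiff ℝ ∞ B) {p : Plane} {a : ℝ}
    (h : HasDerivAt A a (p 0)) : pd 0 (fun p : Plane => A (p 0) - B (p 1)) p = a := by
  refine pd_eq ((contDiff_difference hA hB).differentiable (by simp) p) ?_
  simpa using h.sub_const (B (p 1))

theorem pd_one_difference (hA : ContDiff ℝ ∞ A) (hB : ContDiff ℝ ∞ B) {p : Plane} {b : ℝ}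
    (h : HasDerivAt B b (p 1)) : pd 1 (fun p : Plane => A (p 0) - B (p 1)) p = -b := by
  refine pd_eq ((contDiff_difference hA hB).differentiable (by simp) p) ?_
  simpa using h.const_sub (A (p 0))

end Difference

section TranslationMap

variable {A₁ A₂ B₁ B₂ l₁ m₁ l₂ m₂ : ℝ → ℝ}

theorem contDiff_translationMap (hA₁ : ContDiff ℝ ∞ A₁) (hA₂ : ContDiff ℝ ∞ A₂)
    (hB₁ : ContDiff ℝ ∞ B₁) (hB₂ : ContDiff ℝ ∞ B₂) :
    ContDiff ℝ ∞ (translationMap A₁ A₂ B₁ B₂) := by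
  refine contDiff_pi.2 fun n => ?_
  fin_cases n
  · exact contDiff_difference hA₁ hB₁
  · exact contDiff_difference hA₂ hB₂

theorem fderiv_translationMap (hA₁ : ContDiff ℝ ∞ A₁) (hA₂ : ContDiff ℝ ∞ A₂)
    (hB₁ : ContDiff ℝ ∞ B₁) (hB₂ : ContDiff ℝ ∞ B₂) (dA₁ : ∀ s, HasDerivAt A₁ (l₁ s) s)
    (dA₂ : ∀ s, HasDerivAt A₂ (m₁ s) s) (dB₁ : ∀ s, HasDerivAt B₁ (l₂ s) s)
    (dB₂ : ∀ s, HasDerivAt B₂ (m₂ s) s) (p v : Plane) :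
    fderiv ℝ (translationMap A₁ A₂ B₁ B₂) p v =
      ![l₁ (p 0) * v 0 - l₂ (p 1) * v 1, m₁ (p 0) * v 0 - m₂ (p 1) * v 1] := by
  have hd := (contDiff_translationMap hA₁ hA₂ hB₁ hB₂).differentiable (by simp) p
  have hn : ∀ n, fderiv ℝ (translationMap A₁ A₂ B₁ B₂) p v n
      = fderiv ℝ (fun q => translationMap A₁ A₂ B₁ B₂ q n) p v := fun n => by
    rw [fderiv_pi fun n => differentiableAt_pi.1 hd n]
    rfl
  ext n
  rw [hn, fderiv_eq_pd]
  fin_cases n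
  · change v 0 • pd 0 (fun q : Plane => A₁ (q 0) - B₁ (q 1)) p
      + v 1 • pd 1 (fun q : Plane => A₁ (q 0) - B₁ (q 1)) p = _
    rw [pd_zero_difference hA₁ hB₁ (dA₁ _), pd_one_difference hA₁ hB₁ (dB₁ _)]
    simp
    ring
  · change v 0 • pd 0 (fun q : Plane => A₂ (q 0) - B₂ (q 1)) p
      + v 1 • pd 1 (fun q : Plane => A₂ (q 0) - B₂ (q 1)) p = _
    rw [pd_zero_difference hA₂ hB₂ (dA₂ _), pd_one_difference hA₂ hB₂ (dB₂ _)]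
    simp
    ring

/-- Puts the derivative in the form required by the inverse function theorem; used for flatness, for
openness of the image and for smoothness of the global inverse. -/
theorem exists_fderiv_equiv_translationMap (hA₁ : ContDiff ℝ ∞ A₁) (hA₂ : ContDiff ℝ ∞ A₂)
    (hB₁ : ContDiff ℝ ∞ B₁) (hB₂ : ContDiff ℝ ∞ B₂) (dA₁ : ∀ s, HasDerivAt A₁ (l₁ s) s)
    (dA₂ : ∀ s, HasDerivAt A₂ (m₁ s) s) (dB₁ : ∀ s, HasDerivAt B₁ (l₂ s) s)
    (dB₂ : ∀ s, HasDerivAt B₂ (m₂ s) s) (hdet : ∀ s t, l₁ s * m₂ t - m₁ s * l₂ t ≠ 0) :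
    ∃ Φ' : Plane → Plane ≃L[ℝ] Plane, ∀ p,
      HasStrictFDerivAt (translationMap A₁ A₂ B₁ B₂) (Φ' p : Plane →L[ℝ] Plane) p := by
  have key : ∀ p, ∃ e : Plane ≃L[ℝ] Plane,
      HasStrictFDerivAt (translationMap A₁ A₂ B₁ B₂) (e : Plane →L[ℝ] Plane) p := fun p => by
    have hinj : Function.Injective
        (fderiv ℝ (translationMap A₁ A₂ B₁ B₂) p : Plane →ₗ[ℝ] Plane) := by
      rw [injective_iff_map_eq_zero]
      intro v hv
      have hv' : fderiv ℝ (translationMap A₁ A₂ B₁ B₂) p v = 0 := hv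
      rw [fderiv_translationMap hA₁ hA₂ hB₁ hB₂ dA₁ dA₂ dB₁ dB₂] at hv'
      have h0 : l₁ (p 0) * v 0 - l₂ (p 1) * v 1 = 0 := congrFun hv' 0
      have h1 : m₁ (p 0) * v 0 - m₂ (p 1) * v 1 = 0 := congrFun hv' 1
      ext n
      fin_cases n
      · refine (mul_eq_zero.1 (?_ : v 0 * _ = 0)).resolve_right (hdet (p 0) (p 1))
        linear_combination m₂ (p 1) * h0 - l₂ (p 1) * h1
      · refine (mul_eq_zero.1 (?_ : v 1 * _ = 0)).resolve_right (hdet (p 0) (p 1))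
        linear_combination m₁ (p 0) * h0 - l₁ (p 0) * h1
    refine ⟨(LinearEquiv.ofInjectiveEndo _ hinj).toContinuousLinearEquiv, ?_⟩
    have h := (contDiff_translationMap hA₁ hA₂ hB₁ hB₂).contDiffAt (x := p)
      |>.hasStrictFDerivAt (by simp)
    exact h.congr_fderiv (ContinuousLinearMap.ext fun v => rfl)
  choose e he using key
  exact ⟨e, he⟩

end TranslationMap

/-! ### Flatness -/

/-- The first form of the product surface in arc length parameters. -/
def arcLengthForm (l₁ m₁ l₂ m₂ : ℝ → ℝ) : Form := fun p =>
  !![-1, l₁ (p 0) * l₂ (p 1) - m₁ (p 0) * m₂ (p 1);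
     l₁ (p 0) * l₂ (p 1) - m₁ (p 0) * m₂ (p 1), 1]

section ArcLength

variable {l₁ m₁ l₂ m₂ : ℝ → ℝ}

/-- By the identity `(l₁m₂ - m₁l₂)² - (l₁l₂ - m₁m₂)² = (l₁² - m₁²)(m₂² - l₂²) = 1`, the square of
the determinant is at least 1. -/
theorem frame_det_ne_zero (h₁ : ∀ s, l₁ s ^ 2 = 1 + m₁ s ^ 2) (h₂ : ∀ t, m₂ t ^ 2 = 1 + l₂ t ^ 2)
    (s t : ℝ) : l₁ s * m₂ t - m₁ s * l₂ t ≠ 0 := by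
  intro h
  have h3 : (l₁ s * m₂ t - m₁ s * l₂ t) ^ 2 = 1 + (l₁ s * l₂ t - m₁ s * m₂ t) ^ 2 := by
    linear_combination (m₂ t ^ 2 - l₂ t ^ 2) * h₁ s + h₂ t
  rw [h] at h3
  nlinarith [sq_nonneg (l₁ s * l₂ t - m₁ s * m₂ t)]

theorem isLorentzian_arcLengthForm : IsLorentzian (arcLengthForm l₁ m₁ l₂ m₂) := by
  intro p
  constructor
  · ext i j
    fin_cases i <;> fin_cases j <;> simp [arcLengthForm]
  · simp only [arcLengthForm, Matrix.det_fin_two_of]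
    nlinarith [sq_nonneg (l₁ (p 0) * l₂ (p 1) - m₁ (p 0) * m₂ (p 1))]

theorem isFlat_arcLengthForm (hl₁ : ContDiff ℝ ∞ l₁) (hm₁ : ContDiff ℝ ∞ m₁)
    (hl₂ : ContDiff ℝ ∞ l₂) (hm₂ : ContDiff ℝ ∞ m₂) (h₁ : ∀ s, l₁ s ^ 2 = 1 + m₁ s ^ 2)
    (h₂ : ∀ t, m₂ t ^ 2 = 1 + l₂ t ^ 2) : IsFlat (arcLengthForm l₁ m₁ l₂ m₂) := by
  intro p
  obtain ⟨A₁, sA₁, -, dA₁⟩ := exists_primitive hl₁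
  obtain ⟨A₂, sA₂, -, dA₂⟩ := exists_primitive hm₁
  obtain ⟨B₁, sB₁, -, dB₁⟩ := exists_primitive hl₂
  obtain ⟨B₂, sB₂, -, dB₂⟩ := exists_primitive hm₂
  obtain ⟨Φ', hΦ'⟩ := exists_fderiv_equiv_translationMap sA₁ sA₂ sB₁ sB₂ dA₁ dA₂ dB₁ dB₂
    (frame_det_ne_zero h₁ h₂)
  -- The flat coordinates are the components of the translation map, restricted to a neighbourhood
  -- where the inverse function theorem makes it injective.
  let e := (hΦ' p).toOpenPartialHomeomorph
  refine ⟨e.source, e.open_source, (hΦ' p).mem_toOpenPartialHomeomorph_source,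
    fun q => A₁ (q 0) - B₁ (q 1), fun q => A₂ (q 0) - B₂ (q 1),
    (contDiff_difference sA₁ sB₁).contDiffOn, (contDiff_difference sA₂ sB₂).contDiffOn,
    fun q hq r hr hqr => e.injOn hq hr ?_, fun q _ i j => ?_⟩
  · change translationMap A₁ A₂ B₁ B₂ q = translationMap A₁ A₂ B₁ B₂ r
    simp only [Prod.mk.injEq] at hqr
    simp only [translationMap, hqr.1, hqr.2]
  · have e₁ := h₁ (q 0)
    have e₂ := h₂ (q 1)
    fin_cases i <;> fin_cases j <;>
      simp only [Fin.zero_eta, Fin.mk_one, arcLengthForm, pd_zero_difference sA₁ sB₁ (dA₁ _),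
        pd_zero_difference sA₂ sB₂ (dA₂ _), pd_one_difference sA₁ sB₁ (dB₁ _),
        pd_one_difference sA₂ sB₂ (dB₂ _), Matrix.of_apply, Matrix.cons_val', Matrix.cons_val_zero,
        Matrix.cons_val_one, Matrix.cons_val_fin_one] <;> linarith

end ArcLength

/-- The frame functions of a curve pair. -/
theorem IsCurvePair.exists_frame {b₁ b₂ : ℝ → R42} (h : IsCurvePair b₁ b₂) :
    ∃ l₁ m₁ l₂ m₂ : ℝ → ℝ, ContDiff ℝ ∞ l₁ ∧ ContDiff ℝ ∞ m₁ ∧ ContDiff ℝ ∞ l₂ ∧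
      ContDiff ℝ ∞ m₂ ∧ IsHorizontal b₁ l₁ m₁ ∧ IsHorizontal b₂ l₂ m₂ ∧
      (∀ s, l₁ s ^ 2 = 1 + m₁ s ^ 2) ∧ ∀ t, m₂ t ^ 2 = 1 + l₂ t ^ 2 := by
  obtain ⟨l₁, m₁, sl₁, sm₁, h₁⟩ := isHorizontal_of_orth h.smooth₁ h.mem₁ h.orth₁
  obtain ⟨l₂, m₂, sl₂, sm₂, h₂⟩ := isHorizontal_of_orth h.smooth₂ h.mem₂ h.orth₂
  refine ⟨l₁, m₁, l₂, m₂, sl₁, sm₁, sl₂, sm₂, h₁, h₂, fun s => ?_, fun t => ?_⟩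
  · have := h.timelike₁ s
    rw [h₁.ip_deriv] at this
    linarith
  · have := h.spacelike₂ t
    rw [h₂.ip_deriv] at this
    linarith

theorem IsHorizontal.firstForm_eq_arcLengthForm {b₁ b₂ : ℝ → R42} {l₁ m₁ l₂ m₂ : ℝ → ℝ}
    (h₁ : IsHorizontal b₁ l₁ m₁) (h₂ : IsHorizontal b₂ l₂ m₂) (e₁ : ∀ s, l₁ s ^ 2 = 1 + m₁ s ^ 2)
    (e₂ : ∀ t, m₂ t ^ 2 = 1 + l₂ t ^ 2) :
    firstForm (surface b₁ b₂) = arcLengthForm l₁ m₁ l₂ m₂ := by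
  funext p
  rw [h₁.firstForm_surface h₂, arcLengthForm, e₁, e₂]
  congr <;> ring

theorem IsCurvePair.isImmersion_isLorentzian_isFlat {b₁ b₂ : ℝ → R42} (h : IsCurvePair b₁ b₂) :
    IsImmersion (surface b₁ b₂) ∧ IsLorentzian (firstForm (surface b₁ b₂)) ∧
      IsFlat (firstForm (surface b₁ b₂)) := by
  obtain ⟨l₁, m₁, l₂, m₂, sl₁, sm₁, sl₂, sm₂, h₁, h₂, e₁, e₂⟩ := h.exists_frame
  have hI := h₁.firstForm_eq_arcLengthForm h₂ e₁ e₂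
  refine ⟨⟨h₁.contDiff_surface h₂, h₁.surface_mem h₂, fun p => ?_⟩, ?_, ?_⟩
  · refine fderiv_injective_of_det_ne_zero ?_
    rw [hI]
    exact (isLorentzian_arcLengthForm p).2.ne
  · rw [hI]
    exact isLorentzian_arcLengthForm
  · rw [hI]
    exact isFlat_arcLengthForm sl₁ sm₁ sl₂ sm₂ e₁ e₂

/-! ### The fundamental forms in asymptotic parameters -/

theorem hasAsymptoticForms_surface {a b : ℝ → R42} {ω₁ ω₂ : ℝ → ℝ}
    (h₁ : IsHorizontal a (fun x => Real.cos (ω₁ x)) fun x => Real.sin (ω₁ x))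
    (h₂ : IsHorizontal b (fun y => -Real.cos (ω₂ y)) fun y => Real.sin (ω₂ y)) :
    HasAsymptoticForms (surface a b) ω₁ ω₂ := by
  have sN : ContDiff ℝ ∞ fun s => mul (a s) qj := contDiff_mul h₁.smooth contDiff_const
  have sc : ContDiff ℝ ∞ fun t => conj (b t) := contDiff_conj h₂.smooth
  -- The isometry `x ↦ a x conj b` sends `1` to the point of the surface and vectors in the span of
  -- `i, k` to the tangent vectors; `j` is the remaining orthogonal direction.
  let N : Plane → R42 := fun p => mul (mul (a (p 0)) qj) (conj (b (p 1)))
  have N0 : ∀ p, pd 0 N p = mul (mul (a (p 0)) (ikVec (Real.sin (ω₁ (p 0)))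
      (Real.cos (ω₁ (p 0))))) (conj (b (p 1))) := fun p => by
    refine pd_zero_product (a := fun s => mul (a s) qj) sN sc ?_
    refine (hasDerivAt_mul (h₁.deriv (p 0)) (hasDerivAt_const _ qj)).congr_deriv ?_
    rw [mul_assoc', ikVec_mul_qj]
    ext n
    fin_cases n <;> simp [mul]
  have N1 : ∀ p, pd 1 N p = mul (mul (a (p 0)) (ikVec (Real.sin (ω₂ (p 1)))
      (-Real.cos (ω₂ (p 1))))) (conj (b (p 1))) := fun p => by
    refine (pd_one_product (a := fun s => mul (a s) qj) sN sc (h₂.hasDerivAt_conj (p 1))).trans ?_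
    rw [← mul_assoc', mul_assoc' (a (p 0)), qj_mul_ikVec]
    simp
  have hI := h₁.firstForm_surface h₂
  refine ⟨N, ⟨contDiff_product sN sc, fun p => ?_, fun p => ?_, fun p i => ?_⟩, fun p => ⟨?_, ?_, ?_⟩⟩
  · rw [h₁.ip_sandwich h₂]
    simp [ip, qj]
  · have hf : surface a b p = mul (mul (a (p 0)) one) (conj (b (p 1))) := by
      have : mul (a (p 0)) one = a (p 0) := by
        ext n
        fin_cases n <;> simp [mul, one]
      rw [this, surface]
    rw [hf, h₁.ip_sandwich h₂]
    simp [ip, qj, one]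
  · fin_cases i
    · simp only [Fin.zero_eta]
      rw [h₁.pd_zero_surface h₂, h₁.ip_sandwich h₂]
      simp [ip, qj, ikVec]
    · simp only [Fin.mk_one]
      rw [h₁.pd_one_surface h₂, h₁.ip_sandwich h₂]
      simp [ip, qj, ikVec]
  · rw [hI, Real.cos_two_mul', Real.cos_two_mul', Real.cos_sub]
    ext i j
    fin_cases i <;> fin_cases j <;> simp <;> ring
  · ext i j
    fin_cases i <;> fin_cases j <;>
      simp only [secondForm, Matrix.of_apply, Fin.zero_eta, Fin.mk_one, N0, N1,
        h₁.pd_zero_surface h₂, h₁.pd_one_surface h₂, h₁.ip_sandwich h₂, ip_ikVec, Matrix.cons_val',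
        Matrix.cons_val_zero, Matrix.cons_val_one, Matrix.cons_val_fin_one, Real.sin_add] <;> ring
  · ext i j
    fin_cases i <;> fin_cases j <;>
      simp only [thirdForm, Matrix.of_apply, Fin.zero_eta, Fin.mk_one, N0, N1,
        h₁.ip_sandwich h₂, ip_ikVec, Matrix.cons_val', Matrix.cons_val_zero, Matrix.cons_val_one,
        Matrix.cons_val_fin_one, Real.cos_two_mul', Real.cos_sub] <;> ring

/-! ### Global asymptotic parameters -/

/-- The primitive vanishing at 0 dominates the identity on the positive side and is dominated by it
on the negative side, hence is onto. -/
theorem exists_diffeo_of_one_le {g : ℝ → ℝ} (hg : ContDiff ℝ ∞ g) (h1 : ∀ s, 1 ≤ g s) :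
    ∃ u : ℝ ≃ ℝ, ContDiff ℝ ∞ u ∧ ContDiff ℝ ∞ u.symm ∧ u 0 = 0 ∧ ∀ s, HasDerivAt u (g s) s := by
  obtain ⟨G, sG, G0, dG⟩ := exists_primitive hg
  have hmono : StrictMono G := strictMono_of_hasDerivAt_pos dG fun s => by linarith [h1 s]
  have hsub : Monotone fun s => G s - s :=
    monotone_of_hasDerivAt_nonneg (fun s => (dG s).sub (hasDerivAt_id s)) fun s => by
      simpa using h1 s
  have hsurj : Function.Surjective G := by
    refine sG.continuous.surjective ?_ ?_
    · refine Filter.tendsto_atTop_mono' _ ?_ Filter.tendsto_id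
      filter_upwards [Filter.eventually_ge_atTop 0] with s hs
      have := hsub hs
      simp only [G0, sub_zero, sub_nonneg] at this
      exact this
    · refine Filter.tendsto_atBot_mono' _ ?_ Filter.tendsto_id
      filter_upwards [Filter.eventually_le_atBot 0] with s hs
      have := hsub hs
      simp only [G0, sub_zero, sub_nonpos] at this
      exact this
  let e := hmono.orderIsoOfSurjective G hsurj
  refine ⟨e.toEquiv, sG, ?_, G0, dG⟩
  exact e.toHomeomorph.contDiff_symm_deriv (f' := g) (fun s => by linarith [h1 s]) dG sG

theorem forall_pos_or_forall_neg {g : ℝ → ℝ} (hg : Continuous g) (h : ∀ s, g s ≠ 0) :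
    (∀ s, 0 < g s) ∨ ∀ s, g s < 0 := by
  by_contra! hcon
  obtain ⟨⟨s, hs⟩, t, ht⟩ := hcon
  obtain ⟨r, hr⟩ := mem_range_of_exists_le_of_exists_ge hg ⟨s, hs⟩ ⟨t, ht⟩
  exact h r hr

/-- A diffeomorphism of the line whose derivative has absolute value `g` and the sign of `e`. -/
theorem exists_signed_diffeo {g e : ℝ → ℝ} (hg : ContDiff ℝ ∞ g) (h1 : ∀ s, 1 ≤ g s)
    (he : Continuous e) (he0 : ∀ s, e s ≠ 0) :
    ∃ (u : ℝ ≃ ℝ) (u' : ℝ → ℝ), ContDiff ℝ ∞ u ∧ ContDiff ℝ ∞ u.symm ∧ u 0 = 0 ∧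
      ContDiff ℝ ∞ u' ∧ (∀ s, HasDerivAt u (u' s) s) ∧ (∀ s, u' s ^ 2 = g s ^ 2) ∧
      ∀ s, 0 < e s / u' s := by
  obtain ⟨u, su, su', u0, du⟩ := exists_diffeo_of_one_le hg h1
  rcases forall_pos_or_forall_neg he he0 with h | h
  · exact ⟨u, g, su, su', u0, hg, du, fun _ => rfl, fun s => div_pos (h s) (by linarith [h1 s])⟩
  · refine ⟨u.trans (Equiv.neg ℝ), fun s => -g s, su.neg, su'.comp contDiff_neg, ?_, hg.neg,
      fun s => (du s).neg, fun s => by ring,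
      fun s => div_pos_of_neg_of_neg (h s) (by linarith [h1 s])⟩
    simp [u0]

theorem IsHorizontal.comp {a : ℝ → R42} {l m : ℝ → ℝ} (h : IsHorizontal a l m) {φ φ' : ℝ → ℝ}
    (hφ : ContDiff ℝ ∞ φ) (hd : ∀ r, HasDerivAt φ (φ' r) r) :
    IsHorizontal (a ∘ φ) (fun r => φ' r * l (φ r)) fun r => φ' r * m (φ r) := by
  refine ⟨h.smooth.comp hφ, fun r => h.mem _, fun r => ?_⟩
  refine ((h.deriv (φ r)).scomp r (hd r)).congr_deriv ?_
  ext n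
  fin_cases n <;> simp [mul, ikVec] <;> ring

/-- Reparametrization by the asymptotic parameter, with a prescribed sign. -/
theorem IsHorizontal.exists_asymptotic {a : ℝ → R42} {l m e : ℝ → ℝ} (h : IsHorizontal a l m)
    (hl : ContDiff ℝ ∞ l) (hm : ContDiff ℝ ∞ m) (h1 : ∀ s, 1 ≤ l s ^ 2 + m s ^ 2)
    (he : Continuous e) (he0 : ∀ s, e s ≠ 0) :
    ∃ (u : ℝ ≃ ℝ) (k : ℝ → ℝ), ContDiff ℝ ∞ u ∧ ContDiff ℝ ∞ u.symm ∧ u 0 = 0 ∧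
      ContDiff ℝ ∞ k ∧ (∀ r, 0 < k r * e (u.symm r)) ∧
      (∀ r, (k r * l (u.symm r)) ^ 2 + (k r * m (u.symm r)) ^ 2 = 1) ∧
      IsHorizontal (a ∘ u.symm) (fun r => k r * l (u.symm r)) fun r => k r * m (u.symm r) := by
  have hpos : ∀ s, l s ^ 2 + m s ^ 2 ≠ 0 := fun s => by linarith [h1 s]
  obtain ⟨u, u', su, sv, u0, su', du, hsq, hsign⟩ :=
    exists_signed_diffeo (g := fun s => Real.sqrt (l s ^ 2 + m s ^ 2))
      (((hl.pow 2).add (hm.pow 2)).sqrt hpos) (fun s => Real.one_le_sqrt.2 (h1 s)) he he0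
  have hsq' : ∀ s, u' s ^ 2 = l s ^ 2 + m s ^ 2 := fun s => by
    rw [hsq, Real.sq_sqrt (by linarith [h1 s])]
  have hne : ∀ s, u' s ≠ 0 := fun s h0 => hpos s (by rw [← hsq' s, h0]; ring)
  have dv : ∀ r, HasDerivAt u.symm (u' (u.symm r))⁻¹ r := fun r =>
    (du (u.symm r)).of_local_left_inverse sv.continuous.continuousAt (hne _)
      (Filter.Eventually.of_forall u.apply_symm_apply)
  refine ⟨u, fun r => (u' (u.symm r))⁻¹, su, sv, u0, (su'.comp sv).inv fun r => hne _, fun r => ?_,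
    fun r => ?_, h.comp sv dv⟩
  · have := hsign (u.symm r)
    rwa [div_eq_inv_mul] at this
  · have := hsq' (u.symm r)
    have hn := hne (u.symm r)
    field_simp
    linarith

theorem IsHorizontal.isAsymptoticParameter {a : ℝ → R42} {l m : ℝ → ℝ} (h : IsHorizontal a l m)
    (h1 : ∀ r, l r ^ 2 + m r ^ 2 = 1) : IsAsymptoticParameter a :=
  ⟨h.smooth, h.mem, h.ip_deriv_qj, fun r => ⟨l r, m r, h.conj_mul_deriv r, h1 r⟩⟩

theorem IsCurvePair.exists_asymptoticParameters {b₁ b₂ : ℝ → R42} (h : IsCurvePair b₁ b₂) :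
    ∃ (u v : ℝ ≃ ℝ) (ω₁ ω₂ : ℝ → ℝ), AsymptoticParameters b₁ b₂ u v ω₁ ω₂ ∧
      u 0 = 0 ∧ v 0 = 0 ∧ (∀ x y : ℝ, 0 < ω₁ x + ω₂ y ∧ ω₁ x + ω₂ y < Real.pi) ∧
      HasAsymptoticForms (surface (b₁ ∘ u.symm) (b₂ ∘ v.symm)) ω₁ ω₂ := by
  obtain ⟨l₁, m₁, l₂, m₂, sl₁, sm₁, sl₂, sm₂, h₁, h₂, e₁, e₂⟩ := h.exists_frame
  -- The orientation of `u` follows the sign of `l₁`, that of `v` the sign of `m₂`. The first angle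
  -- thus gets positive cosine and the second positive sine, so `arcsin` and `arccos` recover them.
  obtain ⟨u, k, su, su', u0, sk, hk, hk1, hu⟩ := h₁.exists_asymptotic (e := l₁) sl₁ sm₁
    (fun s => by nlinarith [e₁ s, sq_nonneg (m₁ s)]) sl₁.continuous
    (fun s h0 => by nlinarith [e₁ s, sq_nonneg (m₁ s)])
  obtain ⟨v, j, sv, sv', v0, sj, hj, hj1, hv⟩ := h₂.exists_asymptotic (e := m₂) sl₂ sm₂
    (fun s => by nlinarith [e₂ s, sq_nonneg (l₂ s)]) sm₂.continuous
    (fun s h0 => by nlinarith [e₂ s, sq_nonneg (l₂ s)])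
  set L₁ : ℝ → ℝ := fun r => k r * l₁ (u.symm r) with hL₁
  set M₁ : ℝ → ℝ := fun r => k r * m₁ (u.symm r) with hM₁
  set L₂ : ℝ → ℝ := fun r => j r * l₂ (v.symm r) with hL₂
  set M₂ : ℝ → ℝ := fun r => j r * m₂ (v.symm r) with hM₂
  replace hk : ∀ r, 0 < L₁ r := hk
  replace hj : ∀ r, 0 < M₂ r := hj
  replace hk1 : ∀ r, L₁ r ^ 2 + M₁ r ^ 2 = 1 := hk1
  replace hj1 : ∀ r, L₂ r ^ 2 + M₂ r ^ 2 = 1 := hj1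
  -- Rescaling turns `l₁² - m₁² = 1` into `L₁² - M₁² = k² > 0`: the causal character survives as a
  -- strict inequality, which also keeps `M₁` away from the endpoints where `arcsin` is not smooth.
  have q₁ : ∀ r, M₁ r ^ 2 < L₁ r ^ 2 := fun r => by
    have h0 : k r ≠ 0 := fun h0 => by have := hk r; simp [hL₁, h0] at this
    have : 0 < k r ^ 2 := by positivity
    simp only [hL₁, hM₁, mul_pow, e₁]
    nlinarith
  have q₂ : ∀ r, L₂ r ^ 2 < M₂ r ^ 2 := fun r => by
    have h0 : j r ≠ 0 := fun h0 => by have := hj r; simp [hM₂, h0] at this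
    have : 0 < j r ^ 2 := by positivity
    simp only [hL₂, hM₂, mul_pow, e₂]
    nlinarith
  have hM1 : ∀ r, -1 < M₁ r ∧ M₁ r < 1 := fun r =>
    abs_lt.1 ((sq_lt_one_iff_abs_lt_one _).1 (by nlinarith [hk1 r, q₁ r, hk r]))
  have hL2 : ∀ r, -1 < L₂ r ∧ L₂ r < 1 := fun r =>
    abs_lt.1 ((sq_lt_one_iff_abs_lt_one _).1 (by nlinarith [hj1 r, q₂ r, hj r]))
  have sM₁ : ContDiff ℝ ∞ M₁ := sk.mul (sm₁.comp su')
  have sL₂ : ContDiff ℝ ∞ L₂ := sj.mul (sl₂.comp sv')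
  have sin₁ : ∀ r, Real.sin (Real.arcsin (M₁ r)) = M₁ r := fun r =>
    Real.sin_arcsin (hM1 r).1.le (hM1 r).2.le
  have cos₁ : ∀ r, Real.cos (Real.arcsin (M₁ r)) = L₁ r := fun r => by
    rw [Real.cos_arcsin, ← hk1 r, add_sub_cancel_right, Real.sqrt_sq (hk r).le]
  have cos₂ : ∀ r, Real.cos (Real.arccos (L₂ r)) = L₂ r := fun r =>
    Real.cos_arccos (hL2 r).1.le (hL2 r).2.le
  have sin₂ : ∀ r, Real.sin (Real.arccos (L₂ r)) = M₂ r := fun r => by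
    rw [Real.sin_arccos, ← hj1 r, add_sub_cancel_left, Real.sqrt_sq (hj r).le]
  have sω₁ : ContDiff ℝ ∞ fun r => Real.arcsin (M₁ r) := contDiff_iff_contDiffAt.2 fun r =>
    (Real.contDiffAt_arcsin (hM1 r).1.ne' (hM1 r).2.ne).comp r sM₁.contDiffAt
  have sω₂ : ContDiff ℝ ∞ fun r => Real.arccos (L₂ r) := contDiff_iff_contDiffAt.2 fun r =>
    (Real.contDiffAt_arccos (hL2 r).1.ne' (hL2 r).2.ne).comp r sL₂.contDiffAt
  refine ⟨u, v, fun r => Real.arcsin (M₁ r), fun r => Real.pi - Real.arccos (L₂ r),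
    ⟨su, su', sv, sv', hu.isAsymptoticParameter hk1, hv.isAsymptoticParameter hj1,
      ⟨sω₁, fun r => ?_⟩, ⟨?_, fun r => ?_⟩⟩, u0, v0, fun x y => ?_, ?_⟩
  · rw [hu.conj_mul_deriv, sin₁, cos₁]
  · simpa using sω₂
  · rw [hv.conj_mul_deriv]
    simp only [sub_sub_cancel, sin₂, cos₂]
  -- The difference of the two angles is `π - (ω₁ + ω₂)`. It lies in `[-π/2, 3π/2]`, where a
  -- positive sine forces it into `(0, π)`.
  · have hs : 0 < Real.sin (Real.arccos (L₂ y) - Real.arcsin (M₁ x)) := by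
      rw [Real.sin_sub, sin₁, cos₁, sin₂, cos₂]
      have : (L₂ y * M₁ x) ^ 2 < (M₂ y * L₁ x) ^ 2 := by
        have hlt := mul_lt_mul'' (q₂ y) (q₁ x) (sq_nonneg _) (sq_nonneg _)
        rwa [← mul_pow, ← mul_pow] at hlt
      have := lt_of_abs_lt ((sq_lt_sq₀ (abs_nonneg _) (mul_pos (hj y) (hk x)).le).1
        ((sq_abs (L₂ y * M₁ x)).trans_lt this))
      linarith
    have ha := Real.arccos_nonneg (L₂ y)
    have hb := Real.arccos_le_pi (L₂ y)
    have hc := Real.neg_pi_div_two_le_arcsin (M₁ x)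
    have hd := Real.arcsin_le_pi_div_two (M₁ x)
    have hpi := Real.pi_pos
    constructor
    · by_contra! hcon
      have := Real.sin_nonneg_of_nonneg_of_le_pi
        (x := Real.arccos (L₂ y) - Real.arcsin (M₁ x) - Real.pi) (by linarith) (by linarith)
      rw [Real.sin_sub_pi] at this
      linarith
    · by_contra! hcon
      have := Real.sin_nonpos_of_nonpos_of_neg_pi_le
        (x := Real.arccos (L₂ y) - Real.arcsin (M₁ x)) (by linarith) (by linarith)
      linarith
  · refine hasAsymptoticForms_surface ?_ ?_
    · simpa only [sin₁, cos₁] using hu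
    · simpa only [Real.sin_pi_sub, Real.cos_pi_sub, neg_neg, sin₂, cos₂] using hv

/-! ### Geodesics of the product surface -/

section Geodesics

variable {l₁ m₁ l₂ m₂ : ℝ → ℝ}

/-- A symmetric matrix with diagonal `-1, 1` and off-diagonal entry `F` squares to `1 + F²` times
the identity. -/
theorem inv_arcLengthForm (p : Plane) :
    (arcLengthForm l₁ m₁ l₂ m₂ p)⁻¹ =
      (1 + (l₁ (p 0) * l₂ (p 1) - m₁ (p 0) * m₂ (p 1)) ^ 2)⁻¹ • arcLengthForm l₁ m₁ l₂ m₂ p := by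
  have h : (1 + (l₁ (p 0) * l₂ (p 1) - m₁ (p 0) * m₂ (p 1)) ^ 2) ≠ 0 := by positivity
  refine Matrix.inv_eq_right_inv ?_
  rw [Matrix.mul_smul, inv_smul_eq_iff₀ h]
  ext i j
  fin_cases i <;> fin_cases j <;>
    simp [arcLengthForm, Matrix.mul_apply, Fin.sum_univ_two] <;> ring

theorem contDiff_mixed (hl₁ : ContDiff ℝ ∞ l₁) (hm₁ : ContDiff ℝ ∞ m₁) (hl₂ : ContDiff ℝ ∞ l₂)
    (hm₂ : ContDiff ℝ ∞ m₂) :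
    ContDiff ℝ ∞ fun q : Plane => l₁ (q 0) * l₂ (q 1) - m₁ (q 0) * m₂ (q 1) :=
  ((hl₁.comp (contDiff_coord 0)).mul (hl₂.comp (contDiff_coord 1))).sub
    ((hm₁.comp (contDiff_coord 0)).mul (hm₂.comp (contDiff_coord 1)))

theorem pd_zero_mixed (hl₁ : ContDiff ℝ ∞ l₁) (hm₁ : ContDiff ℝ ∞ m₁) (hl₂ : ContDiff ℝ ∞ l₂)
    (hm₂ : ContDiff ℝ ∞ m₂) (p : Plane) :
    pd 0 (fun q : Plane => l₁ (q 0) * l₂ (q 1) - m₁ (q 0) * m₂ (q 1)) p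
      = deriv l₁ (p 0) * l₂ (p 1) - deriv m₁ (p 0) * m₂ (p 1) := by
  refine pd_eq ((contDiff_mixed hl₁ hm₁ hl₂ hm₂).differentiable (by simp) p) ?_
  simpa using (((hl₁.differentiable (by simp) (p 0)).hasDerivAt).mul_const (l₂ (p 1))).fun_sub
    (((hm₁.differentiable (by simp) (p 0)).hasDerivAt).mul_const (m₂ (p 1)))

theorem pd_one_mixed (hl₁ : ContDiff ℝ ∞ l₁) (hm₁ : ContDiff ℝ ∞ m₁) (hl₂ : ContDiff ℝ ∞ l₂)
    (hm₂ : ContDiff ℝ ∞ m₂) (p : Plane) :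
    pd 1 (fun q : Plane => l₁ (q 0) * l₂ (q 1) - m₁ (q 0) * m₂ (q 1)) p
      = l₁ (p 0) * deriv l₂ (p 1) - m₁ (p 0) * deriv m₂ (p 1) := by
  refine pd_eq ((contDiff_mixed hl₁ hm₁ hl₂ hm₂).differentiable (by simp) p) ?_
  simpa using (((hl₂.differentiable (by simp) (p 1)).hasDerivAt).const_mul (l₁ (p 0))).fun_sub
    (((hm₂.differentiable (by simp) (p 1)).hasDerivAt).const_mul (m₁ (p 0)))

theorem pd_const (i : Fin 2) (r : ℝ) (p : Plane) : pd i (fun _ : Plane => r) p = 0 := by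
  simp [pd]

/-- Since the diagonal of the metric is constant, the mixed symbols `Γᵏ₀₁` vanish and only the
squares of the velocities remain. -/
theorem christoffel_sum_arcLengthForm (hl₁ : ContDiff ℝ ∞ l₁) (hm₁ : ContDiff ℝ ∞ m₁)
    (hl₂ : ContDiff ℝ ∞ l₂) (hm₂ : ContDiff ℝ ∞ m₂) (p v : Plane) (k : Fin 2) :
    ∑ i, ∑ j, christoffel (arcLengthForm l₁ m₁ l₂ m₂) k i j p * v i * v j =
      (1 + (l₁ (p 0) * l₂ (p 1) - m₁ (p 0) * m₂ (p 1)) ^ 2)⁻¹ *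
        (arcLengthForm l₁ m₁ l₂ m₂ p k 1 *
            (deriv l₁ (p 0) * l₂ (p 1) - deriv m₁ (p 0) * m₂ (p 1)) * v 0 ^ 2 +
          arcLengthForm l₁ m₁ l₂ m₂ p k 0 *
            (l₁ (p 0) * deriv l₂ (p 1) - m₁ (p 0) * deriv m₂ (p 1)) * v 1 ^ 2) := by
  have e00 : (fun q => arcLengthForm l₁ m₁ l₂ m₂ q 0 0) = fun _ => -1 := rfl
  have e11 : (fun q => arcLengthForm l₁ m₁ l₂ m₂ q 1 1) = fun _ => 1 := rfl
  have e01 : (fun q => arcLengthForm l₁ m₁ l₂ m₂ q 0 1) =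
    fun q => l₁ (q 0) * l₂ (q 1) - m₁ (q 0) * m₂ (q 1) := rfl
  have e10 : (fun q => arcLengthForm l₁ m₁ l₂ m₂ q 1 0) =
    fun q => l₁ (q 0) * l₂ (q 1) - m₁ (q 0) * m₂ (q 1) := rfl
  simp only [christoffel, Fin.sum_univ_two, e00, e11, e01, e10, pd_const,
    pd_zero_mixed hl₁ hm₁ hl₂ hm₂, pd_one_mixed hl₁ hm₁ hl₂ hm₂, inv_arcLengthForm,
    Matrix.smul_apply, smul_eq_mul]
  ring

/-- The geodesic equations say that the developed curve is not accelerated. -/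
theorem geodesic_equations_iff {l m l' m' n o n' o' x y X Y : ℝ} (e₁ : l ^ 2 = 1 + m ^ 2)
    (e₂ : o ^ 2 = 1 + n ^ 2) (d₁ : l * l' = m * m') (d₂ : o * o' = n * n') :
    (X + (1 + (l * n - m * o) ^ 2)⁻¹ * ((l * n - m * o) * (l' * n - m' * o) * x ^ 2 +
        -1 * (l * n' - m * o') * y ^ 2) = 0 ∧
      Y + (1 + (l * n - m * o) ^ 2)⁻¹ * (1 * (l' * n - m' * o) * x ^ 2 +
        (l * n - m * o) * (l * n' - m * o') * y ^ 2) = 0) ↔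
    (l' * x ^ 2 + l * X - (n' * y ^ 2 + n * Y) = 0 ∧
      m' * x ^ 2 + m * X - (o' * y ^ 2 + o * Y) = 0) := by
  -- `(l, m)` moves on a hyperbola, whose tangent direction is `(m, l)`; likewise for `(n, o)`
  -- below.
  obtain ⟨k, rfl, rfl⟩ : ∃ k, l' = k * m ∧ m' = k * l :=
    ⟨l * m' - m * l', by linear_combination (-l') * e₁ + l * d₁, by
      linear_combination (-m') * e₁ + m * d₁⟩
  obtain ⟨j, rfl, rfl⟩ : ∃ j, n' = j * o ∧ o' = j * n :=
    ⟨o * n' - n * o', by linear_combination (-n') * e₂ + n * d₂, by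
      linear_combination (-o') * e₂ + o * d₂⟩
  have hF : (1 + (l * n - m * o) ^ 2) ≠ 0 := by positivity
  have hD : (l * o - m * n) ^ 2 = 1 + (l * n - m * o) ^ 2 := by
    linear_combination (o ^ 2 - n ^ 2) * e₁ + e₂
  have hD0 : l * o - m * n ≠ 0 := fun h => hF (by rw [← hD, h]; ring)
  generalize hW : k * m * x ^ 2 + l * X - (j * o * y ^ 2 + n * Y) = W
  generalize hZ : k * l * x ^ 2 + m * X - (j * n * y ^ 2 + o * Y) = Z
  -- `(W, Z)` is the acceleration of the developed curve. Up to nonzero factors the two geodesic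
  -- expressions are its determinants with the frame vectors `(n, o)` and `(l, m)`, which are
  -- independent.
  have h₁ : (1 + (l * n - m * o) ^ 2) * (X + (1 + (l * n - m * o) ^ 2)⁻¹ *
      ((l * n - m * o) * (k * m * n - k * l * o) * x ^ 2 +
        -1 * (l * (j * o) - m * (j * n)) * y ^ 2)) = (l * o - m * n) * (o * W - n * Z) := by
    rw [mul_add, mul_inv_cancel_left₀ hF, ← hW, ← hZ]
    linear_combination (-X) * hD + j * (l * o - m * n) * y ^ 2 * e₂
  have h₂ : (1 + (l * n - m * o) ^ 2) * (Y + (1 + (l * n - m * o) ^ 2)⁻¹ *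
      (1 * (k * m * n - k * l * o) * x ^ 2 +
        (l * n - m * o) * (l * (j * o) - m * (j * n)) * y ^ 2)) =
      (l * o - m * n) * (m * W - l * Z) := by
    rw [mul_add, mul_inv_cancel_left₀ hF, ← hW, ← hZ]
    linear_combination (-Y) * hD + k * (l * o - m * n) * x ^ 2 * e₁
  constructor
  · rintro ⟨g₁, g₂⟩
    rw [g₁, mul_zero, eq_comm, mul_eq_zero, or_iff_right hD0] at h₁
    rw [g₂, mul_zero, eq_comm, mul_eq_zero, or_iff_right hD0] at h₂
    constructor
    · refine (mul_eq_zero.1 (?_ : W * _ = 0)).resolve_right hD0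
      linear_combination l * h₁ - n * h₂
    · refine (mul_eq_zero.1 (?_ : Z * _ = 0)).resolve_right hD0
      linear_combination m * h₁ - o * h₂
  · rintro ⟨rfl, rfl⟩
    rw [mul_zero, mul_zero, sub_zero, mul_zero, mul_eq_zero, or_iff_right hF] at h₁ h₂
    exact ⟨h₁, h₂⟩

/-- The two differentiated functions are the components of the velocity of the developed curve, so
geodesics are exactly the smooth curves that develop to constant velocity. -/
theorem isGeodesic_arcLengthForm_iff (hl₁ : ContDiff ℝ ∞ l₁) (hm₁ : ContDiff ℝ ∞ m₁)
    (hl₂ : ContDiff ℝ ∞ l₂) (hm₂ : ContDiff ℝ ∞ m₂) (h₁ : ∀ s, l₁ s ^ 2 = 1 + m₁ s ^ 2)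
    (h₂ : ∀ t, m₂ t ^ 2 = 1 + l₂ t ^ 2) {γ : ℝ → Plane} :
    IsGeodesic (arcLengthForm l₁ m₁ l₂ m₂) γ ↔ ContDiff ℝ ∞ γ ∧ ∀ τ,
      HasDerivAt (fun r => l₁ (γ r 0) * deriv γ r 0 - l₂ (γ r 1) * deriv γ r 1) 0 τ ∧
      HasDerivAt (fun r => m₁ (γ r 0) * deriv γ r 0 - m₂ (γ r 1) * deriv γ r 1) 0 τ := by
  refine and_congr_right fun hγ => forall_congr' fun τ => ?_
  have hγ' : ContDiff ℝ ∞ (deriv γ) := (contDiff_infty_iff_deriv.1 hγ).2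
  have c₁ := hasDerivAt_pi.1 (hγ.differentiable (by simp) τ).hasDerivAt
  have c₂ := hasDerivAt_pi.1 (hγ'.differentiable (by simp) τ).hasDerivAt
  have hd : ∀ {a : ℝ → ℝ} (_ : ContDiff ℝ ∞ a) (r), HasDerivAt a (deriv a r) r := fun ha r =>
    (ha.differentiable (by simp) r).hasDerivAt
  have term : ∀ {a : ℝ → ℝ} (_ : ContDiff ℝ ∞ a) (i),
      HasDerivAt (fun r => a (γ r i) * deriv γ r i)
        (deriv a (γ τ i) * deriv γ τ i ^ 2 + a (γ τ i) * deriv (deriv γ) τ i) τ := fun ha i =>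
    (((hd ha (γ τ i)).comp τ (c₁ i)).mul (c₂ i)).congr_deriv (by simp; ring)
  have diff : ∀ {a b : ℝ → ℝ} (ha : ContDiff ℝ ∞ a) (hb : ContDiff ℝ ∞ b),
      HasDerivAt (fun r => a (γ r 0) * deriv γ r 0 - b (γ r 1) * deriv γ r 1) 0 τ ↔
      deriv a (γ τ 0) * deriv γ τ 0 ^ 2 + a (γ τ 0) * deriv (deriv γ) τ 0 -
        (deriv b (γ τ 1) * deriv γ τ 1 ^ 2 + b (γ τ 1) * deriv (deriv γ) τ 1) = 0 :=
    fun ha hb => ⟨fun h => ((term ha 0).fun_sub (term hb 1)).unique h, fun h =>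
      ((term ha 0).fun_sub (term hb 1)).congr_deriv h⟩
  have d₁ : l₁ (γ τ 0) * deriv l₁ (γ τ 0) = m₁ (γ τ 0) * deriv m₁ (γ τ 0) := by
    have e : (fun s => l₁ s ^ 2) = fun s => 1 + m₁ s ^ 2 := funext h₁
    have := ((hd hl₁ (γ τ 0)).fun_pow 2).unique (e ▸ ((hd hm₁ (γ τ 0)).fun_pow 2).const_add 1)
    simp at this
    linarith
  have d₂ : m₂ (γ τ 1) * deriv m₂ (γ τ 1) = l₂ (γ τ 1) * deriv l₂ (γ τ 1) := by
    have e : (fun s => m₂ s ^ 2) = fun s => 1 + l₂ s ^ 2 := funext h₂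
    have := ((hd hm₂ (γ τ 1)).fun_pow 2).unique (e ▸ ((hd hl₂ (γ τ 1)).fun_pow 2).const_add 1)
    simp at this
    linarith
  rw [diff hl₁ hl₂, diff hm₁ hm₂, ← geodesic_equations_iff (h₁ _) (h₂ _) d₁ d₂, Fin.forall_fin_two,
    christoffel_sum_arcLengthForm hl₁ hm₁ hl₂ hm₂, christoffel_sum_arcLengthForm hl₁ hm₁ hl₂ hm₂]
  rfl

end Geodesics

/-! ### Completeness -/

theorem mul_sub_le_of_hasDerivAt {f f' : ℝ → ℝ} {C x y : ℝ} (hf : ∀ r, HasDerivAt f (f' r) r)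
    (hC : ∀ r, C ≤ f' r) (hxy : x ≤ y) : C * (y - x) ≤ f y - f x :=
  mul_sub_le_image_sub_of_le_deriv (fun r => (hf r).differentiableAt)
    (fun r => (hC r).trans_eq (hf r).deriv.symm) hxy

theorem mul_abs_le_of_hasDerivAt {f f' : ℝ → ℝ} {C : ℝ} (hf : ∀ r, HasDerivAt f (f' r) r)
    (hC : ∀ r, C ≤ f' r) (x y : ℝ) : C * |x - y| ≤ |f x - f y| := by
  rcases le_total x y with h | h
  · rw [abs_sub_comm, abs_sub_comm (f x), abs_of_nonneg (sub_nonneg.2 h)]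
    exact (mul_sub_le_of_hasDerivAt hf hC h).trans (le_abs_self _)
  · rw [abs_of_nonneg (sub_nonneg.2 h)]
    exact (mul_sub_le_of_hasDerivAt hf hC h).trans (le_abs_self _)

theorem lipschitzWith_one_of_hasDerivAt {f f' : ℝ → ℝ} (hf : ∀ r, HasDerivAt f (f' r) r)
    (h1 : ∀ r, |f' r| ≤ 1) : LipschitzWith 1 f :=
  lipschitzWith_of_nnnorm_deriv_le (fun r => (hf r).differentiableAt) fun r => by
    rw [(hf r).deriv, ← NNReal.coe_le_coe]
    exact h1 r

section Unit

variable {a₁ a₂ b₁ b₂ α β : ℝ → ℝ} {c : ℝ}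

/-- The mean value inequality is used once in each variable. The determinant of `a(x)` with the
fixed direction `b'(r)` has `x`-derivative `sin (β r - α x) ≥ c`, so a chord of `a` has determinant
at least `c (x - x')` with every `b'(r)`; that bound is then integrated along `b`. -/
theorem mul_abs_mul_abs_le_det (da₁ : ∀ x, HasDerivAt a₁ (Real.cos (α x)) x)
    (da₂ : ∀ x, HasDerivAt a₂ (Real.sin (α x)) x) (db₁ : ∀ y, HasDerivAt b₁ (Real.cos (β y)) y)
    (db₂ : ∀ y, HasDerivAt b₂ (Real.sin (β y)) y)
    (hsin : ∀ x y, c ≤ Real.sin (β y - α x)) (x x' y y' : ℝ) :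
    c * |x - x'| * |y - y'| ≤
      |(a₁ x - a₁ x') * (b₂ y - b₂ y') - (a₂ x - a₂ x') * (b₁ y - b₁ y')| := by
  wlog hx : x' ≤ x generalizing x x'
  · refine (this x' x (le_of_not_ge hx)).trans' (by rw [abs_sub_comm]) |>.trans_eq ?_
    rw [← abs_neg]
    congr 1
    ring
  have h₁ : ∀ r, c * (x - x') ≤ (a₁ x - a₁ x') * Real.sin (β r) - (a₂ x - a₂ x') * Real.cos (β r) :=
    fun r => by
      refine (mul_sub_le_of_hasDerivAt
        (f := fun z => a₁ z * Real.sin (β r) - a₂ z * Real.cos (β r))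
        (fun z => ((da₁ z).mul_const _).fun_sub ((da₂ z).mul_const _)) (fun z => ?_) hx).trans_eq
        (by ring)
      refine (hsin z r).trans_eq ?_
      rw [Real.sin_sub]
      ring
  have h₂ := mul_abs_le_of_hasDerivAt
    (f := fun z => (a₁ x - a₁ x') * b₂ z - (a₂ x - a₂ x') * b₁ z)
    (fun z => ((db₂ z).const_mul _).fun_sub ((db₁ z).const_mul _)) h₁ y y'
  rw [abs_of_nonneg (sub_nonneg.2 hx)]
  refine h₂.trans_eq ?_
  congr 1
  ring

theorem bijective_translationMap (sa₁ : ContDiff ℝ ∞ a₁) (sa₂ : ContDiff ℝ ∞ a₂)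
    (sb₁ : ContDiff ℝ ∞ b₁) (sb₂ : ContDiff ℝ ∞ b₂)
    (da₁ : ∀ x, HasDerivAt a₁ (Real.cos (α x)) x)
    (da₂ : ∀ x, HasDerivAt a₂ (Real.sin (α x)) x) (db₁ : ∀ y, HasDerivAt b₁ (Real.cos (β y)) y)
    (db₂ : ∀ y, HasDerivAt b₂ (Real.sin (β y)) y) (hc : 0 < c)
    (hsin : ∀ x y, c ≤ Real.sin (β y - α x)) :
    Function.Bijective (translationMap a₁ a₂ b₁ b₂) := by
  have La₁ := lipschitzWith_one_of_hasDerivAt da₁ fun _ => Real.abs_cos_le_one _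
  have La₂ := lipschitzWith_one_of_hasDerivAt da₂ fun _ => Real.abs_sin_le_one _
  have Lb₁ := lipschitzWith_one_of_hasDerivAt db₁ fun _ => Real.abs_cos_le_one _
  have Lb₂ := lipschitzWith_one_of_hasDerivAt db₂ fun _ => Real.abs_sin_le_one _
  have bound : ∀ {f : ℝ → ℝ}, LipschitzWith 1 f → ∀ r r', |f r - f r'| ≤ |r - r'| :=
    fun h r r' => by simpa [Real.dist_eq] using h.dist_le_mul r r'
  have uc : UniformContinuous (translationMap a₁ a₂ b₁ b₂) := by
    have hp : ∀ i : Fin 2, UniformContinuous fun p : Plane => p i := fun i =>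
      Pi.uniformContinuous_proj _ i
    refine uniformContinuous_pi.2 fun n => ?_
    fin_cases n
    · exact (La₁.uniformContinuous.comp (hp 0)).sub (Lb₁.uniformContinuous.comp (hp 1))
    · exact (La₂.uniformContinuous.comp (hp 0)).sub (Lb₂.uniformContinuous.comp (hp 1))
  have anti : AntilipschitzWith (Real.toNNReal (2 / c)) (translationMap a₁ a₂ b₁ b₂) := by
    refine AntilipschitzWith.of_le_mul_dist fun p q => ?_
    rw [Real.coe_toNNReal _ (by positivity), div_mul_eq_mul_div]
    set d := dist (translationMap a₁ a₂ b₁ b₂ p) (translationMap a₁ a₂ b₁ b₂ q) with hd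
    have d₁ : |(a₁ (p 0) - a₁ (q 0)) - (b₁ (p 1) - b₁ (q 1))| ≤ d := by
      have := dist_le_pi_dist (translationMap a₁ a₂ b₁ b₂ p) (translationMap a₁ a₂ b₁ b₂ q) 0
      rw [← hd, Real.dist_eq] at this
      refine this.trans_eq' ?_
      simp only [translationMap, Matrix.cons_val_zero]
      congr 1
      ring
    have d₂ : |(a₂ (p 0) - a₂ (q 0)) - (b₂ (p 1) - b₂ (q 1))| ≤ d := by
      have := dist_le_pi_dist (translationMap a₁ a₂ b₁ b₂ p) (translationMap a₁ a₂ b₁ b₂ q) 1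
      rw [← hd, Real.dist_eq] at this
      refine this.trans_eq' ?_
      simp only [translationMap, Matrix.cons_val_one, Matrix.cons_val_fin_one]
      congr 1
      ring
    have hdet := mul_abs_mul_abs_le_det da₁ da₂ db₁ db₂ hsin (p 0) (q 0) (p 1) (q 1)
    -- When `p` and `q` share a coordinate, the corresponding chord vanishes and cannot be divided
    -- by; the chord over `[0, 1]` serves in its place.
    have hdet₁ := mul_abs_mul_abs_le_det da₁ da₂ db₁ db₂ hsin (p 0) (q 0) 1 0
    have hdet₂ := mul_abs_mul_abs_le_det da₁ da₂ db₁ db₂ hsin 1 0 (p 1) (q 1)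
    have ca₁ := bound La₁ 1 0
    have ca₂ := bound La₂ 1 0
    have cb₁ := bound Lb₁ 1 0
    have cb₂ := bound Lb₂ 1 0
    have ba₁ := bound La₁ (p 0) (q 0)
    have ba₂ := bound La₂ (p 0) (q 0)
    have bb₁ := bound Lb₁ (p 1) (q 1)
    have bb₂ := bound Lb₂ (p 1) (q 1)
    have hd0 : 0 ≤ d := dist_nonneg
    generalize a₁ (p 0) - a₁ (q 0) = P₁ at *
    generalize a₂ (p 0) - a₂ (q 0) = P₂ at *
    generalize b₁ (p 1) - b₁ (q 1) = Q₁ at *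
    generalize b₂ (p 1) - b₂ (q 1) = Q₂ at *
    have det_le : ∀ {x y z w t : ℝ}, |x| ≤ d → |y| ≤ d → |z| ≤ t → |w| ≤ t →
        |x * z - y * w| ≤ 2 * d * t := fun {x y z w t} hx hy hz hw => by
      refine (abs_sub _ _).trans ?_
      rw [abs_mul, abs_mul]
      have := mul_le_mul hx hz (abs_nonneg _) hd0
      have := mul_le_mul hy hw (abs_nonneg _) hd0
      linarith
    -- With chords `P`, `Q` the determinant is unchanged on replacing `P` by `P - Q`, whose
    -- components are at most `d`, while those of `Q` are at most the parameter distance. The two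
    -- products in the determinant give the factor 2.
    have k₁ : c * |p 0 - q 0| * |p 1 - q 1| ≤ 2 * d * |p 1 - q 1| := by
      refine hdet.trans ((det_le d₁ d₂ bb₂ bb₁).trans_eq' ?_)
      congr 1
      ring
    have k₂ : c * |p 0 - q 0| * |p 1 - q 1| ≤ 2 * d * |p 0 - q 0| := by
      refine hdet.trans ((det_le d₁ d₂ ba₂ ba₁).trans_eq' ?_)
      congr 1
      ring
    have r₁ : c * |p 0 - q 0| ≤ 2 * d := by
      rcases (abs_nonneg (p 1 - q 1)).eq_or_lt with h | h
      · rw [← h, abs_nonpos_iff] at bb₁ bb₂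
        rw [bb₁, sub_zero] at d₁
        rw [bb₂, sub_zero] at d₂
        simpa using hdet₁.trans (det_le d₁ d₂ cb₂ cb₁)
      · exact le_of_mul_le_mul_right k₁ h
    have r₂ : c * |p 1 - q 1| ≤ 2 * d := by
      rcases (abs_nonneg (p 0 - q 0)).eq_or_lt with h | h
      · rw [← h, abs_nonpos_iff] at ba₁ ba₂
        rw [ba₁, zero_sub, abs_neg] at d₁
        rw [ba₂, zero_sub, abs_neg] at d₂
        have := det_le d₂ d₁ ca₁ ca₂
        rw [mul_comm Q₂, mul_comm Q₁] at this
        simpa using hdet₂.trans this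
      · refine le_of_mul_le_mul_right (k₂.trans_eq' ?_) h
        ring
    rw [dist_pi_le_iff (by positivity), Fin.forall_fin_two,
      Real.dist_eq, Real.dist_eq, le_div_iff₀' hc, le_div_iff₀' hc]
    exact ⟨r₁, r₂⟩
  have hdet : ∀ x y, Real.cos (α x) * Real.sin (β y) - Real.sin (α x) * Real.cos (β y) ≠ 0 :=
    fun x y h => by
      have := hsin x y
      rw [Real.sin_sub] at this
      linarith
  obtain ⟨Φ', hΦ'⟩ := exists_fderiv_equiv_translationMap sa₁ sa₂ sb₁ sb₂ da₁ da₂ db₁ db₂ hdet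
  -- Closed by the antilipschitz bound and completeness of the plane, open by the inverse function
  -- theorem; connectedness gives surjectivity.
  have hclopen : IsClopen (Set.range (translationMap a₁ a₂ b₁ b₂)) :=
    ⟨anti.isClosed_range uc, (isOpenMap_of_hasStrictFDerivAt_equiv hΦ').isOpen_range⟩
  exact ⟨anti.injective, Set.range_eq_univ.1 (hclopen.eq_univ (Set.range_nonempty _))⟩

end Unit

theorem IsHorizontal.angle_eq {a : ℝ → R42} {l m θ : ℝ → ℝ} (h : IsHorizontal a l m)
    (hθ : IsAngleFunction a θ) (r : ℝ) : l r = Real.cos (θ r) ∧ m r = Real.sin (θ r) := by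
  have := hθ.2 r
  rw [h.conj_mul_deriv, ← ikVec_eq, ← ikVec_eq] at this
  exact ⟨congrFun this 1, congrFun this 3⟩

/-- The primitives of the frame functions, in the asymptotic parameter. -/
theorem IsHorizontal.hasDerivAt_primitive_comp {b : ℝ → R42} {l m A₁ A₂ θ φ : ℝ → ℝ}
    (h : IsHorizontal b l m) (dA₁ : ∀ s, HasDerivAt A₁ (l s) s) (dA₂ : ∀ s, HasDerivAt A₂ (m s) s)
    (hφ : ContDiff ℝ ∞ φ) (hθ : IsAngleFunction (b ∘ φ) θ) (r : ℝ) :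
    HasDerivAt (A₁ ∘ φ) (Real.cos (θ r)) r ∧ HasDerivAt (A₂ ∘ φ) (Real.sin (θ r)) r := by
  have dφ : ∀ r, HasDerivAt φ (_root_.deriv φ r) r := fun r =>
    (hφ.differentiable (by simp) r).hasDerivAt
  obtain ⟨e₁, e₂⟩ := (h.comp hφ dφ).angle_eq hθ r
  refine ⟨?_, ?_⟩
  · rw [← e₁, mul_comm]
    exact (dA₁ (φ r)).comp r (dφ r)
  · rw [← e₂, mul_comm]
    exact (dA₂ (φ r)).comp r (dφ r)

/-- Bridges the two parametrizations: the antilipschitz estimate holds in asymptotic parameters, the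
geodesic equations are treated in arc length. -/
theorem bijective_translationMap_of_comp {A₁ A₂ B₁ B₂ : ℝ → ℝ} (u v : ℝ ≃ ℝ)
    (h : Function.Bijective
      (translationMap (A₁ ∘ u.symm) (A₂ ∘ u.symm) (B₁ ∘ v.symm) (B₂ ∘ v.symm))) :
    Function.Bijective (translationMap A₁ A₂ B₁ B₂) := by
  have key : ∀ p : Plane, translationMap (A₁ ∘ u.symm) (A₂ ∘ u.symm) (B₁ ∘ v.symm) (B₂ ∘ v.symm)
      ![u (p 0), v (p 1)] = translationMap A₁ A₂ B₁ B₂ p := fun p => by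
    simp [translationMap]
  constructor
  · intro p q hpq
    rw [← key, ← key] at hpq
    have := h.1 hpq
    ext n
    fin_cases n
    · exact u.injective (congrFun this 0)
    · exact v.injective (congrFun this 1)
  · intro q
    obtain ⟨r, rfl⟩ := h.2 q
    refine ⟨![u.symm (r 0), v.symm (r 1)], ?_⟩
    simp [translationMap]

/-- The required geodesic is the preimage of the straight line through the image point with the
pushed-forward velocity. -/
theorem geodesicallyComplete_of_bijective {l₁ m₁ l₂ m₂ A₁ A₂ B₁ B₂ : ℝ → ℝ}
    (hl₁ : ContDiff ℝ ∞ l₁) (hm₁ : ContDiff ℝ ∞ m₁)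
    (hl₂ : ContDiff ℝ ∞ l₂) (hm₂ : ContDiff ℝ ∞ m₂) (h₁ : ∀ s, l₁ s ^ 2 = 1 + m₁ s ^ 2)
    (h₂ : ∀ t, m₂ t ^ 2 = 1 + l₂ t ^ 2)
    (hA₁ : ContDiff ℝ ∞ A₁) (hA₂ : ContDiff ℝ ∞ A₂)
    (hB₁ : ContDiff ℝ ∞ B₁) (hB₂ : ContDiff ℝ ∞ B₂) (dA₁ : ∀ s, HasDerivAt A₁ (l₁ s) s)
    (dA₂ : ∀ s, HasDerivAt A₂ (m₁ s) s) (dB₁ : ∀ s, HasDerivAt B₁ (l₂ s) s)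
    (dB₂ : ∀ s, HasDerivAt B₂ (m₂ s) s)
    (hbij : Function.Bijective (translationMap A₁ A₂ B₁ B₂)) :
    GeodesicallyComplete (arcLengthForm l₁ m₁ l₂ m₂) := by
  obtain ⟨Φ', hΦ'⟩ := exists_fderiv_equiv_translationMap hA₁ hA₂ hB₁ hB₂ dA₁ dA₂ dB₁ dB₂
    (frame_det_ne_zero h₁ h₂)
  have hsm := contDiff_translationMap hA₁ hA₂ hB₁ hB₂
  let e : Plane ≃ₜ Plane := (Equiv.ofBijective _ hbij).toHomeomorphOfContinuousOpen hsm.continuous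
    (isOpenMap_of_hasStrictFDerivAt_equiv hΦ')
  have se : ContDiff ℝ ∞ e.symm := e.contDiff_symm (fun p => (hΦ' p).hasFDerivAt) hsm
  intro p v
  set w : Plane := fderiv ℝ (translationMap A₁ A₂ B₁ B₂) p v with hw
  let line : ℝ → Plane := fun τ => e p + τ • w
  have dline : ∀ τ, HasDerivAt line w τ := fun τ => by
    exact (((hasDerivAt_id τ).smul_const w).const_add (e p)).congr_deriv (one_smul ℝ w)
  have sline : ContDiff ℝ ∞ line := contDiff_const.add (contDiff_id.smul contDiff_const)
  have sγ : ContDiff ℝ ∞ (e.symm ∘ line) := se.comp sline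
  have γ0 : (e.symm ∘ line) 0 = p := by simp [line]
  have dγ : ∀ τ, fderiv ℝ (translationMap A₁ A₂ B₁ B₂) ((e.symm ∘ line) τ)
      (deriv (e.symm ∘ line) τ) = w := fun τ => by
    have h := (hsm.differentiable (by simp) ((e.symm ∘ line) τ)).hasFDerivAt.comp_hasDerivAt τ
      (sγ.differentiable (by simp) τ).hasDerivAt
    have hc : translationMap A₁ A₂ B₁ B₂ ∘ (e.symm ∘ line) = line :=
      funext fun r => e.apply_symm_apply (line r)
    rw [hc] at h
    exact h.unique (dline τ)
  refine ⟨e.symm ∘ line, ?_, γ0, ?_⟩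
  · refine (isGeodesic_arcLengthForm_iff hl₁ hm₁ hl₂ hm₂ h₁ h₂).2 ⟨sγ, fun τ => ?_⟩
    simp only [fderiv_translationMap hA₁ hA₂ hB₁ hB₂ dA₁ dA₂ dB₁ dB₂] at dγ
    have c₁ := fun r => congrFun (dγ r) 0
    have c₂ := fun r => congrFun (dγ r) 1
    simp only [Matrix.cons_val_zero, Matrix.cons_val_one, Matrix.cons_val_fin_one] at c₁ c₂
    rw [funext c₁, funext c₂]
    exact ⟨hasDerivAt_const _ _, hasDerivAt_const _ _⟩
  · have h := dγ 0
    rw [γ0, hw, (hΦ' p).hasFDerivAt.fderiv] at h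
    exact (Φ' p).injective h

theorem IsCurvePair.geodesicallyComplete {b₁ b₂ : ℝ → R42} (h : IsCurvePair b₁ b₂)
    {u v : ℝ ≃ ℝ} {ω₁ ω₂ : ℝ → ℝ} (hp : AsymptoticParameters b₁ b₂ u v ω₁ ω₂) {c : ℝ}
    (hc : 0 < c) (hsin : ∀ x y, c ≤ Real.sin (ω₁ x + ω₂ y)) :
    GeodesicallyComplete (firstForm (surface b₁ b₂)) := by
  obtain ⟨l₁, m₁, l₂, m₂, sl₁, sm₁, sl₂, sm₂, h₁, h₂, e₁, e₂⟩ := h.exists_frame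
  obtain ⟨A₁, sA₁, -, dA₁⟩ := exists_primitive sl₁
  obtain ⟨A₂, sA₂, -, dA₂⟩ := exists_primitive sm₁
  obtain ⟨B₁, sB₁, -, dB₁⟩ := exists_primitive sl₂
  obtain ⟨B₂, sB₂, -, dB₂⟩ := exists_primitive sm₂
  have dA := h₁.hasDerivAt_primitive_comp dA₁ dA₂ hp.smooth_u_symm hp.angle₁
  have dB := h₂.hasDerivAt_primitive_comp dB₁ dB₂ hp.smooth_v_symm hp.angle₂
  rw [h₁.firstForm_eq_arcLengthForm h₂ e₁ e₂]
  refine geodesicallyComplete_of_bijective sl₁ sm₁ sl₂ sm₂ e₁ e₂ sA₁ sA₂ sB₁ sB₂ dA₁ dA₂ dB₁ dB₂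
    (bijective_translationMap_of_comp u v ?_)
  refine bijective_translationMap (sA₁.comp hp.smooth_u_symm) (sA₂.comp hp.smooth_u_symm)
    (sB₁.comp hp.smooth_v_symm) (sB₂.comp hp.smooth_v_symm) (fun x => (dA x).1) (fun x => (dA x).2)
    (fun y => (dB y).1) (fun y => (dB y).2) hc fun x y => ?_
  -- The direction angles of the two plane curves are `ω₁` and `π - ω₂`.
  rw [show Real.pi - ω₂ y - ω₁ x = Real.pi - (ω₁ x + ω₂ y) by ring, Real.sin_pi_sub]
  exact hsin x y

/-! ### An incomplete surface -/

theorem IsHorizontal.isCurvePair {b₁ b₂ : ℝ → R42} {l₁ m₁ l₂ m₂ : ℝ → ℝ}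
    (h₁ : IsHorizontal b₁ l₁ m₁) (h₂ : IsHorizontal b₂ l₂ m₂) (e₁ : ∀ s, l₁ s ^ 2 = 1 + m₁ s ^ 2)
    (e₂ : ∀ t, m₂ t ^ 2 = 1 + l₂ t ^ 2) (z₁ : b₁ 0 = one) (z₂ : b₂ 0 = one) :
    IsCurvePair b₁ b₂ where
  smooth₁ := h₁.smooth
  smooth₂ := h₂.smooth
  mem₁ := h₁.mem
  mem₂ := h₂.mem
  zero₁ := z₁
  zero₂ := z₂
  timelike₁ s := by rw [h₁.ip_deriv, e₁]; ring
  spacelike₂ t := by rw [h₂.ip_deriv, e₂]; ring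
  orth₁ := h₁.ip_deriv_qj
  orth₂ := h₂.ip_deriv_qj

/-- The curve `(1 + s (i - j)) exp (s j)`. -/
def timelikeCurve (s : ℝ) : R42 :=
  ![Real.cosh s - s * Real.sinh s, s * Real.cosh s, Real.sinh s - s * Real.cosh s,
    s * Real.sinh s]

/-- The curve `(cosh (5 t / 4) + sinh (5 t / 4) (4 k - 3 j) / 5) exp (3 t j / 4)`. -/
def spacelikeCurve (t : ℝ) : R42 :=
  ![Real.cosh (5 / 4 * t) * Real.cosh (3 / 4 * t) -
      3 / 5 * (Real.sinh (5 / 4 * t) * Real.sinh (3 / 4 * t)),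
    4 / 5 * (Real.sinh (5 / 4 * t) * Real.sinh (3 / 4 * t)),
    Real.cosh (5 / 4 * t) * Real.sinh (3 / 4 * t) -
      3 / 5 * (Real.sinh (5 / 4 * t) * Real.cosh (3 / 4 * t)),
    4 / 5 * (Real.sinh (5 / 4 * t) * Real.cosh (3 / 4 * t))]

/-- As `(i - j)² = 0`, the curve is `exp (s (i - j)) exp (s j)`. Hence `conj a · a' = exp (-s j) i
exp (s j) = i exp (2 s j)`, because `i` and `j` anticommute. -/
theorem isHorizontal_timelikeCurve :
    IsHorizontal timelikeCurve (fun s => Real.cosh (2 * s)) fun s => Real.sinh (2 * s) where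
  smooth := by
    refine contDiff_pi.2 fun n => ?_
    have hc := Real.contDiff_cosh (n := ∞)
    have hs := Real.contDiff_sinh (n := ∞)
    fin_cases n
    · exact hc.sub (contDiff_id.mul hs)
    · exact contDiff_id.mul hc
    · exact hs.sub (contDiff_id.mul hc)
    · exact contDiff_id.mul hs
  mem s := by
    change ip _ _ = -1
    simp only [ip, timelikeCurve, Matrix.cons_val_zero, Matrix.cons_val_one, Matrix.cons_val]
    linear_combination (-1) * Real.cosh_sq s
  deriv s := by
    refine hasDerivAt_pi.2 fun n => ?_
    have hc := Real.hasDerivAt_cosh s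
    have hs := Real.hasDerivAt_sinh s
    have q := Real.cosh_sq s
    have hi := hasDerivAt_id s
    fin_cases n
    · refine (hc.sub (hi.mul hs)).congr_deriv ?_
      simp [mul, ikVec, timelikeCurve, Real.cosh_two_mul, Real.sinh_two_mul]
      linear_combination (s * Real.cosh s) * q
    · refine (hi.mul hc).congr_deriv ?_
      simp [mul, ikVec, timelikeCurve, Real.cosh_two_mul, Real.sinh_two_mul]
      linear_combination (-Real.cosh s - s * Real.sinh s) * q
    · refine (hs.sub (hi.mul hc)).congr_deriv ?_
      simp [mul, ikVec, timelikeCurve, Real.cosh_two_mul, Real.sinh_two_mul]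
      linear_combination (s * Real.sinh s) * q
    · refine (hi.mul hs).congr_deriv ?_
      simp [mul, ikVec, timelikeCurve, Real.cosh_two_mul, Real.sinh_two_mul]
      linear_combination (-Real.sinh s - s * Real.cosh s) * q

/-- The same construction with generator `k - (3/4) j`, so that `conj b · b' = k exp (3 t j / 2)`.
The value 3/4 makes the square of the generator, `1 + 9/16 = (5/4)²`, a rational square. -/
theorem isHorizontal_spacelikeCurve :
    IsHorizontal spacelikeCurve (fun t => Real.sinh (2 * (3 / 4 * t)))
      fun t => Real.cosh (2 * (3 / 4 * t)) where
  smooth := by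
    refine contDiff_pi.2 fun n => ?_
    have hl : ∀ a : ℝ, ContDiff ℝ ∞ fun t : ℝ => a * t := fun a => contDiff_const.mul contDiff_id
    have hC := (hl (5 / 4)).cosh
    have hS := (hl (5 / 4)).sinh
    have hc := (hl (3 / 4)).cosh
    have hs := (hl (3 / 4)).sinh
    fin_cases n
    · exact (hC.mul hc).sub (contDiff_const.mul (hS.mul hs))
    · exact contDiff_const.mul (hS.mul hs)
    · exact (hC.mul hs).sub (contDiff_const.mul (hS.mul hc))
    · exact contDiff_const.mul (hS.mul hc)
  mem t := by
    change ip _ _ = -1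
    simp only [ip, spacelikeCurve, Matrix.cons_val_zero, Matrix.cons_val_one, Matrix.cons_val]
    linear_combination (-1 * (Real.cosh (3 / 4 * t) ^ 2 - Real.sinh (3 / 4 * t) ^ 2)) *
      Real.cosh_sq (5 / 4 * t) - Real.cosh_sq (3 / 4 * t)
  deriv t := by
    refine hasDerivAt_pi.2 fun n => ?_
    have hl : ∀ a : ℝ, HasDerivAt (fun t : ℝ => a * t) a t := fun a => by
      simpa using (hasDerivAt_id t).const_mul a
    have hC := (hl (5 / 4)).cosh
    have hS := (hl (5 / 4)).sinh
    have hc := (hl (3 / 4)).cosh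
    have hs := (hl (3 / 4)).sinh
    have q := Real.cosh_sq (3 / 4 * t)
    have two_sinh := Real.sinh_two_mul (3 / 4 * t)
    have two_cosh := Real.cosh_two_mul (3 / 4 * t)
    fin_cases n
    · refine ((hC.mul hc).sub ((hS.mul hs).const_mul (3 / 5))).congr_deriv ?_
      simp [mul, ikVec, spacelikeCurve]
      rw [two_sinh, two_cosh]
      linear_combination (-4 / 5 * Real.sinh (5 / 4 * t) * Real.cosh (3 / 4 * t)) * q
    · refine ((hS.mul hs).const_mul (4 / 5)).congr_deriv ?_
      simp [mul, ikVec, spacelikeCurve]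
      rw [two_sinh, two_cosh]
      linear_combination (-(Real.cosh (5 / 4 * t) * Real.sinh (3 / 4 * t)) -
        3 / 5 * Real.sinh (5 / 4 * t) * Real.cosh (3 / 4 * t)) * q
    · refine ((hC.mul hs).sub ((hS.mul hc).const_mul (3 / 5))).congr_deriv ?_
      simp [mul, ikVec, spacelikeCurve]
      rw [two_sinh, two_cosh]
      linear_combination (-4 / 5 * Real.sinh (5 / 4 * t) * Real.sinh (3 / 4 * t)) * q
    · refine ((hS.mul hc).const_mul (4 / 5)).congr_deriv ?_
      simp [mul, ikVec, spacelikeCurve]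
      rw [two_sinh, two_cosh]
      linear_combination (-(Real.cosh (5 / 4 * t) * Real.cosh (3 / 4 * t)) -
        3 / 5 * Real.sinh (5 / 4 * t) * Real.sinh (3 / 4 * t)) * q

theorem exists_isCurvePair_not_geodesicallyComplete : ∃ b₁ b₂ : ℝ → R42, IsCurvePair b₁ b₂ ∧
    ¬ GeodesicallyComplete (firstForm (surface b₁ b₂)) := by
  have e₁ : ∀ s, Real.cosh (2 * s) ^ 2 = 1 + Real.sinh (2 * s) ^ 2 := fun s => by
    rw [Real.cosh_sq, add_comm]
  have e₂ : ∀ t, Real.cosh (2 * (3 / 4 * t)) ^ 2 = 1 + Real.sinh (2 * (3 / 4 * t)) ^ 2 := fun t =>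
    e₁ _
  refine ⟨timelikeCurve, spacelikeCurve,
    isHorizontal_timelikeCurve.isCurvePair isHorizontal_spacelikeCurve e₁ e₂ ?_ ?_, fun hcomp => ?_⟩
  · simp [timelikeCurve, one]
  · simp [spacelikeCurve, one]
  rw [isHorizontal_timelikeCurve.firstForm_eq_arcLengthForm isHorizontal_spacelikeCurve e₁ e₂]
    at hcomp
  have hl : ∀ a : ℝ, ContDiff ℝ ∞ fun t : ℝ => a * t := fun a => contDiff_const.mul contDiff_id
  have hl' : ContDiff ℝ ∞ fun t : ℝ => 2 * (3 / 4 * t) := contDiff_const.mul (hl _)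
  obtain ⟨γ, hγ, γ0, γ1⟩ := hcomp 0 ![1, 0]
  obtain ⟨sγ, hlin⟩ := (isGeodesic_arcLengthForm_iff (hl 2).cosh (hl 2).sinh hl'.sinh hl'.cosh
    e₁ e₂).1 hγ
  have c := fun τ => hasDerivAt_pi.1 (sγ.differentiable (by simp) τ).hasDerivAt
  -- The null coordinate `y - x` of the developed geodesic, up to a constant: its derivative
  -- combines `cosh - sinh` at the two arguments, which are decaying exponentials. It is positive
  -- everywhere yet affine along geodesics.
  let H : ℝ → ℝ := fun τ => 1 / 2 * Real.exp (-2 * γ τ 0) + 2 / 3 * Real.exp (-(3 / 2) * γ τ 1)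
  let H' : ℝ → ℝ := fun τ =>
    (Real.sinh (2 * γ τ 0) * deriv γ τ 0 - Real.cosh (2 * (3 / 4 * γ τ 1)) * deriv γ τ 1) -
    (Real.cosh (2 * γ τ 0) * deriv γ τ 0 - Real.sinh (2 * (3 / 4 * γ τ 1)) * deriv γ τ 1)
  have hH : ∀ τ, HasDerivAt H (H' τ) τ := fun τ => by
    have h₁ := (((c τ 0).const_mul (-2)).exp.const_mul (1 / 2)).add
      ((((c τ 1).const_mul (-(3 / 2))).exp).const_mul (2 / 3))
    refine h₁.congr_deriv ?_
    have k₁ := Real.cosh_sub_sinh (2 * γ τ 0)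
    have k₂ := Real.cosh_sub_sinh (2 * (3 / 4 * γ τ 1))
    rw [show -2 * γ τ 0 = -(2 * γ τ 0) by ring,
      show -(3 / 2) * γ τ 1 = -(2 * (3 / 4 * γ τ 1)) by ring, ← k₁, ← k₂]
    simp only [H']
    ring
  have hH' : ∀ τ, HasDerivAt H' 0 τ := fun τ => by
    simpa using (hlin τ).2.fun_sub (hlin τ).1
  have H'const : ∀ τ, H' τ = -1 := fun τ => by
    rw [is_const_of_deriv_eq_zero (fun r => (hH' r).differentiableAt) (fun r => (hH' r).deriv) τ 0]
    simp [H', γ0, γ1]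
  have hconst : ∀ τ, HasDerivAt (fun r => H r + r) 0 τ := fun τ =>
    ((hH τ).add (hasDerivAt_id τ)).congr_deriv (by rw [H'const]; ring)
  -- Decreasing at unit rate from `H 0`, the function would vanish at time `H 0`.
  have hfin := is_const_of_deriv_eq_zero (fun r => (hconst r).differentiableAt)
    (fun r => (hconst r).deriv) (H 0) 0
  have hpos : 0 < H (H 0) := by positivity
  simp only [add_zero] at hfin
  linarith

end AntiDeSitter

end

theorem mainTheorem6 :
    (∀ b₁ b₂ : ℝ → AntiDeSitter.R42, AntiDeSitter.IsCurvePair b₁ b₂ →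
      -- the surface is a timelike flat surface without singular points
      (AntiDeSitter.IsImmersion (AntiDeSitter.surface b₁ b₂) ∧
        AntiDeSitter.IsLorentzian (AntiDeSitter.firstForm (AntiDeSitter.surface b₁ b₂)) ∧
        AntiDeSitter.IsFlat (AntiDeSitter.firstForm (AntiDeSitter.surface b₁ b₂))) ∧
      -- the asymptotic parameters are globally defined
      (∃ (u v : ℝ ≃ ℝ) (ω₁ ω₂ : ℝ → ℝ),
        AntiDeSitter.AsymptoticParameters b₁ b₂ u v ω₁ ω₂ ∧
        u 0 = 0 ∧ v 0 = 0 ∧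
        (∀ x y : ℝ, 0 < ω₁ x + ω₂ y ∧ ω₁ x + ω₂ y < Real.pi) ∧
        AntiDeSitter.HasAsymptoticForms
          (AntiDeSitter.surface (b₁ ∘ u.symm) (b₂ ∘ v.symm)) ω₁ ω₂) ∧
      -- completeness when the sine of the angle function is bounded away from zero
      (∀ (u v : ℝ ≃ ℝ) (ω₁ ω₂ : ℝ → ℝ),
        AntiDeSitter.AsymptoticParameters b₁ b₂ u v ω₁ ω₂ →
        (∃ c : ℝ, 0 < c ∧ ∀ x y : ℝ, c ≤ Real.sin (ω₁ x + ω₂ y)) →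
        AntiDeSitter.GeodesicallyComplete
          (AntiDeSitter.firstForm (AntiDeSitter.surface b₁ b₂)))) ∧
    -- completeness fails in general
    (∃ b₁ b₂ : ℝ → AntiDeSitter.R42, AntiDeSitter.IsCurvePair b₁ b₂ ∧
      ¬ AntiDeSitter.GeodesicallyComplete
        (AntiDeSitter.firstForm (AntiDeSitter.surface b₁ b₂))) := by
  exact ⟨fun b₁ b₂ h => ⟨h.isImmersion_isLorentzian_isFlat, h.exists_asymptoticParameters,
      fun _ _ _ _ hp ⟨_, hc, hsin⟩ => h.geodesicallyComplete hp hc hsin⟩,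
    AntiDeSitter.exists_isCurvePair_not_geodesicallyComplete⟩
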